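/- Let $d\ge 1$ and let $X=\mathbb N_0^{\mathbb Z^d}$ with the product topology and product $\sigma$-algebra; let $X_f\subset X$ be the countable set of configurations with finitely many particles, $\sum_x\eta(x)<\infty$. Let $g:\mathbb N_0\to[0,\infty)$ satisfy $g(0)=0$, $g(k)>0$ for $k\ge1$, $g(n)\le g(n+1)$ for all $n$, and $\lim_{n\to\infty}g(n)=\infty$. Let $(p(z))_{z\in\mathbb Z^d}$ satisfy $p(z)\ge 0$ and $\sum_z p(z)=1$, and put $p(x,y)=p(y-x)$. For $t\ge 0$ let $S(t)$ be the Markov semigroup of the zero-range process on $X_f$, i.e. of the pure jump Markov process with generator $$Lf(\eta)=\sum_{x\ne y} g(\eta(x))\,p(x,y)\,\bigl(f(\eta^{x,y})-f(\eta)\bigr),\qquad \eta\in X_f,$$ where $\eta^{x,y}$ is obtained from $\eta$ by moving one particle from $x$ to $y$. The number of particles is conserved and the jump rates are bounded for each given number of particles, so that $S(t)f(\eta)=\sum_{k\ge0}\frac{t^k}{k!}L^kf(\eta)$ for bounded $f$. For a probability measure $\nu$ on $X_f$, let $\nu S(t)$ be the law at time $t$ of the process with initial law $\nu$. For a probability measure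 $\mu$ on $X$, let $[\mu]_n$ be the law on $X_f$ of the configuration obtained from a $\mu$-distributed one by removing all particles outside $[-n,n]^d$, and let $\mu_t$ be the weak limit of $[\mu]_nS(t)$ on $X$ as $n\to\infty$, whenever it exists. For $\phi>0$ let $\mu_\phi$ be the product measure on $X$ with $$\mu_\phi(\eta(x)=k)=\frac{w(k)\phi^k}{z(\phi)},\qquad x\in\mathbb Z^d,\ k\in\mathbb N_0,\qquad w(k)=\prod_{j=1}^k\frac1{g(j)},\qquad z(\phi)=\sum_{k\ge0}w(k)\phi^k<\infty .$$ **Theorem (Invariant measures).** For every $\phi\in(0,\infty)$ and every $t\ge 0$, $(\mu_\phi)_t$ exists and $(\mu_\phi)_t=\mu_\phi$; that is, $[\mu_\phi]_nS(t)\to\mu_\phi$ weakly as $n\to\infty$. -/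

import Mathlib

open Filter Topology MeasureTheory

noncomputable section

namespace ZeroRange

/-- Sites: the integer lattice `ℤ^d`. -/
abbrev Site (d : ℕ) : Type := Fin d → ℤ

/-- The configuration space `X = ℕ₀^(ℤ^d)`, with its product topology and product σ-algebra. -/
abbrev Config (d : ℕ) : Type := Site d → ℕ

/-- `X_f`: the configurations with finitely many particles (a countable set). -/
abbrev FinConfig (d : ℕ) : Type := Site d →₀ ℕ

/-- The countable space `X_f` carries the discrete σ-algebra. -/
instance instMeasurableSpaceFinConfig (d : ℕ) : MeasurableSpace (FinConfig d) := ⊤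

/-- Rate functions: `g(0) = 0`, a non-empty site has a positive jump rate (this is what gives a
meaning to the weights `∏ 1 / g(j)`), and `g` is non-decreasing and diverges at infinity. -/
structure IsRate (g : ℕ → ℝ) : Prop where
  zero : g 0 = 0
  pos : ∀ k, 1 ≤ k → 0 < g k
  mono : Monotone g
  diverges : Tendsto g atTop atTop

/-- Translation invariant transition probabilities `p(x,y) = p(y - x)` on `ℤ^d`: a probability
vector `p` on `ℤ^d`. -/
structure IsJumpLaw {d : ℕ} (p : Site d → ℝ) : Prop where
  nonneg : ∀ z, 0 ≤ p z
  hasSum : HasSum p 1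

/-! ### The dynamics on finite configurations -/

/-- `η^{x,y}` for `η(x) ≥ 1`: one particle is moved from `x` to `y`. -/
def move {d : ℕ} (η : FinConfig d) (x y : Site d) : FinConfig d :=
  η - Finsupp.single x 1 + Finsupp.single y 1

/-- The generator `L f(η) = ∑_{x, y} g(η(x)) p(y - x) (f(η^{x,y}) - f(η))` on `X_f`.
Sites `x` with `η(x) = 0` do not contribute since `g(0) = 0`, so the sum over `x` is over the
occupied sites; for an occupied `x`, the term `y = x` vanishes since then `η^{x,x} = η`. -/
def generator {d : ℕ} (g : ℕ → ℝ) (p : Site d → ℝ) (f : FinConfig d → ℝ) : FinConfig d → ℝ :=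
  fun η => ∑ x ∈ η.support, ∑' y, g (η x) * p (y - x) * (f (move η x y) - f η)

/-- The Markov semigroup on `X_f` associated to `L`, `S(t) f(η) = ∑_k (t^k / k!) L^k f(η)`.
The dynamics conserves the number of particles, and on the configurations with `N` particles the
total jump rate is at most `N g(N)`; there `L` is a bounded operator on bounded functions, the
series converges absolutely, and `S(t) f(η) = E^η f(η_t)` for the pure jump Markov process `η_t`
in which a particle jumps from `x` to `y` at rate `g(η(x)) p(y - x)`. -/
def semigroup {d : ℕ} (g : ℕ → ℝ) (p : Site d → ℝ) (t : ℝ) (f : FinConfig d → ℝ) :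
    FinConfig d → ℝ :=
  fun η => ∑' k : ℕ, t ^ k / (k.factorial : ℝ) * ((generator g p)^[k] f) η

/-- The transition probabilities `P^η(η_t = ξ) = S(t) 1_{ξ} (η)`. -/
def transitionProb {d : ℕ} (g : ℕ → ℝ) (p : Site d → ℝ) (t : ℝ) (η ξ : FinConfig d) : ℝ :=
  semigroup g p t (Set.indicator {ξ} fun _ => 1) η

/-- The law of `η_t` for the process started from `η ∈ X_f`. -/
def lawAt {d : ℕ} (g : ℕ → ℝ) (p : Site d → ℝ) (t : ℝ) (η : FinConfig d) :
    Measure (FinConfig d) :=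
  Measure.sum fun ξ => ENNReal.ofReal (transitionProb g p t η ξ) • Measure.dirac ξ

/-- The measure `μ S(t)` for a measure `μ` on `X_f`: the law at time `t` of the process with
initial distribution `μ`. -/
def evolveFin {d : ℕ} (g : ℕ → ℝ) (p : Site d → ℝ) (t : ℝ) (μ : Measure (FinConfig d)) :
    Measure (FinConfig d) :=
  μ.bind (lawAt g p t)

/-! ### The dynamics started from a measure on infinite configurations -/

/-- The box `[-n, n]^d`. -/
def box (d n : ℕ) : Finset (Site d) :=
  Finset.Icc (fun _ => -(n : ℤ)) (fun _ => (n : ℤ))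

/-- Remove all particles outside `[-n, n]^d`. -/
def truncate {d : ℕ} (n : ℕ) (η : Config d) : FinConfig d :=
  Finsupp.indicator (box d n) fun x _ => η x

/-- `[μ]_n`: the image of `μ` under the removal of all particles outside `[-n, n]^d`. -/
def truncMeasure {d : ℕ} (n : ℕ) (μ : Measure (Config d)) : Measure (FinConfig d) :=
  μ.map (truncate n)

/-- `[μ]_n S(t)`, seen as a measure on `X`. -/
def approxLaw {d : ℕ} (g : ℕ → ℝ) (p : Site d → ℝ) (t : ℝ) (n : ℕ) (μ : Measure (Config d)) :
    Measure (Config d) :=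
  (evolveFin g p t (truncMeasure n μ)).map fun η : FinConfig d => (η : Config d)

/-- `μ_t` exists and is equal to `ν`: the measures `[μ]_n S(t)` are probability measures on `X`
which converge weakly to `ν` as `n → ∞`. -/
def EvolvesTo {d : ℕ} (g : ℕ → ℝ) (p : Site d → ℝ) (t : ℝ) (μ ν : ProbabilityMeasure (Config d)) :
    Prop :=
  ∃ h : ∀ n, IsProbabilityMeasure (approxLaw g p t n (μ : Measure (Config d))),
    Tendsto (β := ProbabilityMeasure (Config d))
      (fun n => ⟨approxLaw g p t n (μ : Measure (Config d)), h n⟩) atTop (𝓝 ν)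

/-! ### The product measures `μ_φ` -/

/-- `w(k) = ∏_{j=1}^k 1 / g(j)`. -/
def weight (g : ℕ → ℝ) (k : ℕ) : ℝ :=
  ∏ j ∈ Finset.Icc 1 k, 1 / g j

theorem weight_pos {g : ℕ → ℝ} (hg : IsRate g) (k : ℕ) : 0 < weight g k :=
  Finset.prod_pos fun j hj => one_div_pos.2 (hg.pos j (Finset.mem_Icc.1 hj).1)

theorem summable_weight {g : ℕ → ℝ} (hg : IsRate g) {φ : ℝ} (hφ : 0 < φ) :
    Summable fun k => weight g k * φ ^ k := by
  have hpos : ∀ k, 0 < weight g k * φ ^ k := fun k => mul_pos (weight_pos hg k) (pow_pos hφ k)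
  refine summable_of_ratio_test_tendsto_lt_one (l := 0) one_pos
    (Eventually.of_forall fun k => (hpos k).ne') ?_
  have h1 : Tendsto (fun k => φ / g (k + 1)) atTop (𝓝 0) :=
    (tendsto_const_nhds (x := φ)).div_atTop (hg.diverges.comp (tendsto_add_atTop_nat 1))
  refine h1.congr fun k => ?_
  rw [Real.norm_of_nonneg (hpos _).le, Real.norm_of_nonneg (hpos _).le]
  have h2 : weight g (k + 1) = weight g k * (1 / g (k + 1)) := by
    unfold weight
    rw [Finset.prod_Icc_succ_top (by omega)]
  have h3 := (weight_pos hg k).ne'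
  have h4 := (hg.pos (k + 1) (by omega)).ne'
  rw [h2, pow_succ]
  field_simp

/-- The one-site marginal `k ↦ w(k) φ^k / z(φ)`, with `z(φ) = ∑_k w(k) φ^k`. -/
def sitePMF {g : ℕ → ℝ} (hg : IsRate g) {φ : ℝ} (hφ : 0 < φ) : PMF ℕ :=
  PMF.normalize (fun k => ENNReal.ofReal (weight g k * φ ^ k))
    (fun h => absurd (ENNReal.tsum_eq_zero.1 h 0)
      (ENNReal.ofReal_pos.2 (mul_pos (weight_pos hg 0) (pow_pos hφ 0))).ne')
    (summable_weight hg hφ).tsum_ofReal_ne_top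

/-- The product measure `μ_φ` on `X`, under which the occupation numbers `η(x)` are independent
with law `w(k) φ^k / z(φ)`. -/
def fugacityMeasure (d : ℕ) {g : ℕ → ℝ} (hg : IsRate g) {φ : ℝ} (hφ : 0 < φ) :
    ProbabilityMeasure (Config d) :=
  ⟨Measure.infinitePi fun _ : Site d => (sitePMF hg hφ).toMeasure, inferInstance⟩

end ZeroRange

end

/-!
The product measures `μ_φ` are invariant for the zero-range process. Since `g` need not be
Lipschitz, the argument rests on attractivity rather than on estimates for the infinite system.

* The process is attractive: `S(t)` preserves monotone functions (`semigroup_monotone`). On each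
  layer of bounded particle number `L + c` does so for large `c` (`posGen_monotoneOn`), and
  `exp(ct) S(t) = exp(t(L + c))` (`exp_mul_semigroup`). So the laws `[μ_φ]_Λ S(t)` increase
  with `Λ`.
* They stay below `μ_φ` (`lintegral_evolved_le`). With respect to the weights
  `∏_x w(η(x)) φ^η(x)`, the adjoint of the process is the zero-range process with reversed jumps
  (`gibbs_mul_transitionProb`). Hence the density of `[μ_φ]_Λ S(t)` is, up to a constant, the
  probability that the reversed process is inside `Λ` at time `t`. By attractivity this is a
  decreasing function, and the FKG inequality applies.
* No mass is lost in the limit (`density_le_iSup_siteMean`). By domination the mean jump rates are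
  at most `φ`, so a box `Λ` loses at most `t φ ∑_{x ∈ Λ} p(x, Λᶜ) = o(|Λ|)` particles up to
  time `t` (`card_mul_density_le`). Monotonicity in `Λ` and translation invariance turn this bound
  on an average into the convergence of the mean of every occupation number to its value under
  `μ_φ` (`tendsto_siteMean_box`).
* Domination and convergence of the means imply weak convergence. For an event `C` in a finite set
  `A`, the function `∑_{x ∈ A} η(x) + 1_{Cᶜ}(η)` is monotone. So domination bounds the probability
  of `C` from below up to the loss of mass in `A` (`sum_siteMean_add_measure_le`), and the
  portmanteau theorem applies.
-/

noncomputable section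

namespace ZeroRange

variable {d : ℕ} {g : ℕ → ℝ} {p : Site d → ℝ}

/-! ### The generator on functions bounded on layers -/

theorem IsRate.nonneg (hg : IsRate g) (k : ℕ) : 0 ≤ g k :=
  hg.zero ▸ hg.mono (Nat.zero_le k)

theorem IsJumpLaw.hasSum_sub (hp : IsJumpLaw p) (x : Site d) : HasSum (fun y => p (y - x)) 1 :=
  (Equiv.subRight x).hasSum_iff.2 hp.hasSum

/-- Boundedness on each set of configurations with at most `N` particles. On these sets the jump
rates are bounded, and they are invariant under the dynamics; so `L` acts on such functions. -/
def LayerBdd (f : FinConfig d → ℝ) : Prop :=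
  ∀ N : ℕ, ∃ C : ℝ, ∀ η : FinConfig d, η.degree ≤ N → |f η| ≤ C

theorem LayerBdd.of_bound {f : FinConfig d → ℝ} (C : ℝ) (h : ∀ η, |f η| ≤ C) : LayerBdd f :=
  fun _ => ⟨C, fun η _ => h η⟩

theorem LayerBdd.const (C : ℝ) : LayerBdd (fun _ : FinConfig d => C) :=
  .of_bound |C| fun _ => le_rfl

theorem LayerBdd.add {f h : FinConfig d → ℝ} (hf : LayerBdd f) (hh : LayerBdd h) :
    LayerBdd (f + h) := fun N => by
  obtain ⟨A, hA⟩ := hf N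
  obtain ⟨B, hB⟩ := hh N
  exact ⟨A + B, fun η hη => (abs_add_le _ _).trans (add_le_add (hA η hη) (hB η hη))⟩

theorem LayerBdd.const_mul {f : FinConfig d → ℝ} (hf : LayerBdd f) (c : ℝ) :
    LayerBdd (fun η => c * f η) := fun N => by
  obtain ⟨A, hA⟩ := hf N
  refine ⟨|c| * A, fun η hη => ?_⟩
  rw [abs_mul]
  exact mul_le_mul_of_nonneg_left (hA η hη) (abs_nonneg c)

theorem degree_move {η : FinConfig d} {x : Site d} (hx : x ∈ η.support) (y : Site d) :
    (move η x y).degree = η.degree := by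
  have hle : Finsupp.single x 1 ≤ η := by
    rw [Finsupp.single_le_iff]
    exact Nat.one_le_iff_ne_zero.2 (Finsupp.mem_support_iff.1 hx)
  have h : (η - Finsupp.single x 1 + Finsupp.single x 1).degree = η.degree := by
    rw [tsub_add_cancel_of_le hle]
  rw [map_add, Finsupp.degree_single] at h
  rw [move, map_add, Finsupp.degree_single, h]

theorem move_mono {η ζ : FinConfig d} (h : η ≤ ζ) (x y : Site d) : move η x y ≤ move ζ x y :=
  add_le_add_left (tsub_le_tsub_right h _) _

/-- If `ζ` has a particle at `x` which `η` has not, then `η` stays below `ζ` when this particle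
moves. -/
theorem le_move {η ζ : FinConfig d} (h : η ≤ ζ) {x : Site d} (hx : η x < ζ x) (y : Site d) :
    η ≤ move ζ x y := by
  intro z
  have hz := h z
  simp only [move, Finsupp.add_apply, Finsupp.tsub_apply, Finsupp.single_apply]
  split_ifs with h1 h2 h2
  · omega
  · subst h1; omega
  · omega
  · omega

/-- The average of `f` over the configurations obtained from `η` by a jump from `x`. -/
def hopAvg (p : Site d → ℝ) (f : FinConfig d → ℝ) (η : FinConfig d) (x : Site d) : ℝ :=
  ∑' y, p (y - x) * f (move η x y)

theorem summable_hop (hp : IsJumpLaw p) {f : FinConfig d → ℝ} (hf : LayerBdd f) {η : FinConfig d}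
    {x : Site d} (hx : x ∈ η.support) : Summable fun y => p (y - x) * f (move η x y) := by
  obtain ⟨C, hC⟩ := hf η.degree
  refine Summable.of_norm_bounded ((hp.hasSum_sub x).summable.mul_right C) fun y => ?_
  rw [Real.norm_eq_abs, abs_mul, abs_of_nonneg (hp.nonneg _)]
  exact mul_le_mul_of_nonneg_left (hC _ (degree_move hx y).le) (hp.nonneg _)

theorem generator_eq (hp : IsJumpLaw p) {f : FinConfig d → ℝ} (hf : LayerBdd f) (η : FinConfig d) :
    generator g p f η = ∑ x ∈ η.support, g (η x) * (hopAvg p f η x - f η) := by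
  refine Finset.sum_congr rfl fun x hx => ?_
  have h1 := (summable_hop hp hf hx).hasSum.sub ((hp.hasSum_sub x).mul_right (f η))
  rw [one_mul] at h1
  rw [hopAvg, ← (h1.mul_left (g (η x))).tsum_eq]
  exact tsum_congr fun y => by ring

theorem abs_hopAvg_le (hp : IsJumpLaw p) {f : FinConfig d → ℝ} {C : ℝ} {η : FinConfig d}
    {x : Site d} (hC : ∀ y, |f (move η x y)| ≤ C) : |hopAvg p f η x| ≤ C := by
  have h := (hp.hasSum_sub x).mul_right C
  rw [one_mul] at h
  refine tsum_of_norm_bounded (E := ℝ) h fun y => ?_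
  rw [Real.norm_eq_abs, abs_mul, abs_of_nonneg (hp.nonneg _)]
  exact mul_le_mul_of_nonneg_left (hC y) (hp.nonneg _)

theorem hopAvg_add (hp : IsJumpLaw p) {f h : FinConfig d → ℝ} (hf : LayerBdd f) (hh : LayerBdd h)
    {η : FinConfig d} {x : Site d} (hx : x ∈ η.support) :
    hopAvg p (f + h) η x = hopAvg p f η x + hopAvg p h η x := by
  rw [hopAvg, hopAvg, hopAvg, ← (summable_hop hp hf hx).tsum_add (summable_hop hp hh hx)]
  exact tsum_congr fun y => by simp [mul_add]

/-- The total jump rate of a configuration. -/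
def exitRate (g : ℕ → ℝ) (η : FinConfig d) : ℝ := ∑ x ∈ η.support, g (η x)

theorem exitRate_le (hg : IsRate g) {N : ℕ} {η : FinConfig d} (hη : η.degree ≤ N) :
    exitRate g η ≤ N * g N := by
  have h1 : (η.support.card : ℝ) ≤ N := by
    have : η.support.card ≤ η.degree := by
      rw [Finsupp.degree_apply, Finset.card_eq_sum_ones]
      exact Finset.sum_le_sum fun x hx =>
        Nat.one_le_iff_ne_zero.2 (Finsupp.mem_support_iff.1 hx)
    exact_mod_cast this.trans hη
  calc exitRate g η ≤ ∑ x ∈ η.support, g N := Finset.sum_le_sum fun x _ =>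
        hg.mono ((Finsupp.le_degree x η).trans hη)
    _ = η.support.card * g N := by rw [Finset.sum_const, nsmul_eq_mul]
    _ ≤ N * g N := mul_le_mul_of_nonneg_right h1 (hg.nonneg N)

theorem abs_generator_le (hg : IsRate g) (hp : IsJumpLaw p) {f : FinConfig d → ℝ}
    (hf : LayerBdd f) {N : ℕ} {C : ℝ} (hC : ∀ η : FinConfig d, η.degree ≤ N → |f η| ≤ C)
    {η : FinConfig d} (hη : η.degree ≤ N) : |generator g p f η| ≤ 2 * (N * g N) * C := by
  have hC0 : 0 ≤ C := (abs_nonneg _).trans (hC η hη)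
  rw [generator_eq hp hf]
  calc |∑ x ∈ η.support, g (η x) * (hopAvg p f η x - f η)|
      ≤ ∑ x ∈ η.support, g (η x) * (2 * C) := by
        refine (Finset.abs_sum_le_sum_abs _ _).trans (Finset.sum_le_sum fun x hx => ?_)
        rw [abs_mul, abs_of_nonneg (hg.nonneg _)]
        refine mul_le_mul_of_nonneg_left ((abs_sub _ _).trans ?_) (hg.nonneg _)
        have := abs_hopAvg_le hp (fun y => hC _ ((degree_move hx y).trans_le hη))
        linarith [hC η hη]
    _ = exitRate g η * (2 * C) := by rw [exitRate, Finset.sum_mul]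
    _ ≤ (N * g N) * (2 * C) := mul_le_mul_of_nonneg_right (exitRate_le hg hη) (by positivity)
    _ = _ := by ring

theorem LayerBdd.generator (hg : IsRate g) (hp : IsJumpLaw p) {f : FinConfig d → ℝ}
    (hf : LayerBdd f) : LayerBdd (generator g p f) := fun N => by
  obtain ⟨C, hC⟩ := hf N
  exact ⟨_, fun η hη => abs_generator_le hg hp hf hC hη⟩

theorem LayerBdd.generator_iterate (hg : IsRate g) (hp : IsJumpLaw p) {f : FinConfig d → ℝ}
    (hf : LayerBdd f) (k : ℕ) : LayerBdd ((ZeroRange.generator g p)^[k] f) := by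
  induction k with
  | zero => exact hf
  | succ k ih => rw [Function.iterate_succ_apply']; exact ih.generator hg hp

theorem abs_generator_iterate_le (hg : IsRate g) (hp : IsJumpLaw p) {f : FinConfig d → ℝ}
    (hf : LayerBdd f) {N : ℕ} {C : ℝ} (hC : ∀ η : FinConfig d, η.degree ≤ N → |f η| ≤ C) (k : ℕ)
    {η : FinConfig d} (hη : η.degree ≤ N) :
    |((generator g p)^[k] f) η| ≤ (2 * (N * g N)) ^ k * C := by
  induction k generalizing η with
  | zero => simpa using hC η hη
  | succ k ih =>
    rw [Function.iterate_succ_apply']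
    refine (abs_generator_le hg hp (hf.generator_iterate hg hp k) (fun ξ hξ => ih hξ) hη).trans
      (le_of_eq ?_)
    ring

theorem generator_add (hp : IsJumpLaw p) {f h : FinConfig d → ℝ} (hf : LayerBdd f)
    (hh : LayerBdd h) : generator g p (f + h) = generator g p f + generator g p h := by
  funext η
  rw [Pi.add_apply, generator_eq hp hf, generator_eq hp hh, generator_eq hp (hf.add hh),
    ← Finset.sum_add_distrib]
  refine Finset.sum_congr rfl fun x hx => ?_
  rw [hopAvg_add hp hf hh hx, Pi.add_apply]
  ring

theorem generator_smul (c : ℝ) (f : FinConfig d → ℝ) :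
    generator g p (c • f) = c • generator g p f := by
  funext η
  simp only [generator, Pi.smul_apply, smul_eq_mul, Finset.mul_sum, ← tsum_mul_left]
  exact Finset.sum_congr rfl fun x _ => tsum_congr fun y => by ring

theorem generator_const (C : ℝ) : generator g p (fun _ => C) = 0 := by
  funext η
  simp [generator]

/-- The functions bounded on layers, as a vector space. -/
def layerSpace (d : ℕ) : Submodule ℝ (FinConfig d → ℝ) where
  carrier := {f | LayerBdd f}
  add_mem' hf hh := LayerBdd.add hf hh
  zero_mem' := LayerBdd.const 0
  smul_mem' c _ hf := LayerBdd.const_mul hf c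

/-- The generator as an endomorphism of the space of functions bounded on layers. -/
def genEnd (hg : IsRate g) (hp : IsJumpLaw p) : Module.End ℝ (layerSpace d) where
  toFun f := ⟨generator g p f, LayerBdd.generator hg hp f.2⟩
  map_add' f h := Subtype.ext (generator_add hp f.2 h.2)
  map_smul' c f := Subtype.ext (generator_smul c f.1)

theorem genEnd_pow_coe (hg : IsRate g) (hp : IsJumpLaw p) (k : ℕ) (f : layerSpace d) :
    ((genEnd hg hp ^ k) f : FinConfig d → ℝ) = (generator g p)^[k] f := by
  induction k with
  | zero => rfl
  | succ k ih =>
    rw [pow_succ', Function.iterate_succ_apply', ← ih]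
    rfl

/-! ### The semigroup -/

/-- The operator `L + c`. If `c` is at least the total jump rate on a layer, it is positive there,
and `S(t) = exp(-ct) exp(t(L + c))` inherits its properties. -/
def posGen (g : ℕ → ℝ) (p : Site d → ℝ) (c : ℝ) (f : FinConfig d → ℝ) : FinConfig d → ℝ :=
  fun η => generator g p f η + c * f η

theorem LayerBdd.posGen (hg : IsRate g) (hp : IsJumpLaw p) {f : FinConfig d → ℝ}
    (hf : LayerBdd f) (c : ℝ) : LayerBdd (posGen g p c f) :=
  (hf.generator hg hp).add (hf.const_mul c)

theorem LayerBdd.posGen_iterate (hg : IsRate g) (hp : IsJumpLaw p) {f : FinConfig d → ℝ}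
    (hf : LayerBdd f) (c : ℝ) (k : ℕ) : LayerBdd ((ZeroRange.posGen g p c)^[k] f) := by
  induction k with
  | zero => exact hf
  | succ k ih => rw [Function.iterate_succ_apply']; exact ih.posGen hg hp c

theorem posGen_iterate_eq (hg : IsRate g) (hp : IsJumpLaw p) {f : FinConfig d → ℝ}
    (hf : LayerBdd f) (c : ℝ) (n : ℕ) (η : FinConfig d) :
    ((posGen g p c)^[n] f) η =
      ∑ kl ∈ Finset.HasAntidiagonal.antidiagonal n, (n.choose kl.1 : ℝ) *
        (((generator g p)^[kl.1] f) η * c ^ kl.2) := by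
  have h1 : ∀ k, (((genEnd hg hp + algebraMap ℝ _ c) ^ k) ⟨f, hf⟩ : layerSpace d).1
      = (posGen g p c)^[k] f := by
    intro k
    induction k with
    | zero => rfl
    | succ k ih =>
      rw [pow_succ', Function.iterate_succ_apply', ← ih]
      rfl
  let ev : layerSpace d →ₗ[ℝ] ℝ := (LinearMap.proj η).comp (layerSpace d).subtype
  have h2 : ∀ F : layerSpace d, F.1 η = ev F := fun _ => rfl
  have h3 : Commute (genEnd hg hp) (algebraMap ℝ _ c) := (Algebra.commutes c (genEnd hg hp)).symm
  rw [← h1, h2, h3.add_pow', LinearMap.sum_apply, map_sum]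
  refine Finset.sum_congr rfl fun kl _ => ?_
  rw [LinearMap.smul_apply, map_nsmul, nsmul_eq_mul, ← h2, (h3.pow_pow kl.1 kl.2).eq, ← map_pow,
    Module.End.mul_apply, Module.algebraMap_end_apply, ← genEnd_pow_coe hg hp kl.1 ⟨f, hf⟩]
  simp [mul_comm]

theorem summable_semigroup (hg : IsRate g) (hp : IsJumpLaw p) {f : FinConfig d → ℝ}
    (hf : LayerBdd f) (t : ℝ) (η : FinConfig d) :
    Summable fun k : ℕ => ‖t ^ k / (k.factorial : ℝ) * ((generator g p)^[k] f) η‖ := by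
  obtain ⟨C, hC⟩ := hf η.degree
  refine Summable.of_nonneg_of_le (fun _ => norm_nonneg _) (fun k => ?_)
    ((Real.summable_pow_div_factorial (|t| * (2 * (η.degree * g η.degree)))).mul_right C)
  rw [Real.norm_eq_abs, abs_mul, abs_div, abs_pow, Nat.abs_cast, mul_pow]
  calc _ ≤ |t| ^ k / (k.factorial : ℝ) * ((2 * (η.degree * g η.degree)) ^ k * C) :=
        mul_le_mul_of_nonneg_left (abs_generator_iterate_le hg hp hf hC k le_rfl) (by positivity)
    _ = _ := by ring

/-- The identity `exp(ct) S(t) = exp(t(L + c))`. -/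
theorem exp_mul_semigroup (hg : IsRate g) (hp : IsJumpLaw p) {f : FinConfig d → ℝ}
    (hf : LayerBdd f) (c t : ℝ) (η : FinConfig d) :
    HasSum (fun n : ℕ => t ^ n / (n.factorial : ℝ) * ((posGen g p c)^[n] f) η)
      (Real.exp (c * t) * semigroup g p t f η) := by
  have h1 := summable_semigroup hg hp hf t η
  have h2 : Summable fun k : ℕ => ‖(c * t) ^ k / (k.factorial : ℝ)‖ :=
    NormedSpace.norm_expSeries_div_summable (c * t)
  have h3 : Real.exp (c * t) = ∑' k : ℕ, (c * t) ^ k / (k.factorial : ℝ) := by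
    rw [Real.exp_eq_exp_ℝ, NormedSpace.exp_eq_tsum_div]
  have h4 : ∀ n : ℕ, ∑ kl ∈ Finset.HasAntidiagonal.antidiagonal n,
      t ^ kl.1 / (kl.1.factorial : ℝ) * ((generator g p)^[kl.1] f) η *
        ((c * t) ^ kl.2 / (kl.2.factorial : ℝ)) =
      t ^ n / (n.factorial : ℝ) * ((posGen g p c)^[n] f) η := by
    intro n
    rw [posGen_iterate_eq hg hp hf, Finset.mul_sum]
    refine Finset.sum_congr rfl fun kl hkl => ?_
    have hn : kl.1 + kl.2 = n := Finset.HasAntidiagonal.mem_antidiagonal.1 hkl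
    have hfac : (n.choose kl.1 : ℝ) * kl.1.factorial * kl.2.factorial = n.factorial := by
      rw [← hn]
      have := Nat.choose_mul_factorial_mul_factorial (Nat.le_add_right kl.1 kl.2)
      rw [Nat.add_sub_cancel_left] at this
      exact_mod_cast this
    rw [← hfac, ← hn, mul_pow, pow_add]
    have e1 := Nat.factorial_ne_zero kl.1
    have e2 := Nat.factorial_ne_zero kl.2
    have e3 : ((kl.1 + kl.2).choose kl.1 : ℝ) ≠ 0 := by
      exact_mod_cast (Nat.choose_pos (Nat.le_add_right _ _)).ne'
    field_simp
  rw [mul_comm, semigroup, h3, tsum_mul_tsum_eq_tsum_sum_antidiagonal_of_summable_norm h1 h2]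
  rw [tsum_congr h4]
  refine Summable.hasSum ?_
  exact (summable_norm_sum_mul_antidiagonal_of_summable_norm h1 h2).of_norm.congr
    fun n => h4 n

theorem hopAvg_le_hopAvg (hp : IsJumpLaw p) {f h : FinConfig d → ℝ} (hf : LayerBdd f)
    (hh : LayerBdd h) {η ζ : FinConfig d} {x : Site d} (hx : x ∈ η.support) (hx' : x ∈ ζ.support)
    (hle : ∀ y, f (move η x y) ≤ h (move ζ x y)) : hopAvg p f η x ≤ hopAvg p h ζ x :=
  (summable_hop hp hf hx).tsum_le_tsum
    (fun y => mul_le_mul_of_nonneg_left (hle y) (hp.nonneg _)) (summable_hop hp hh hx')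

theorem hopAvg_const (hp : IsJumpLaw p) (C : ℝ) (η : FinConfig d) (x : Site d) :
    hopAvg p (fun _ => C) η x = C := by
  rw [hopAvg, ((hp.hasSum_sub x).mul_right C).tsum_eq, one_mul]

theorem posGen_eq (hp : IsJumpLaw p) {f : FinConfig d → ℝ} (hf : LayerBdd f) (c : ℝ)
    (η : FinConfig d) :
    posGen g p c f η =
      ∑ x ∈ η.support, g (η x) * hopAvg p f η x + (c - exitRate g η) * f η := by
  rw [posGen, generator_eq hp hf, exitRate, sub_mul, Finset.sum_mul]
  simp only [mul_sub, Finset.sum_sub_distrib]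
  ring

theorem posGen_nonneg (hg : IsRate g) (hp : IsJumpLaw p) {f : FinConfig d → ℝ} (hf : LayerBdd f)
    {N : ℕ} {c : ℝ} (hc : N * g N ≤ c) (h0 : ∀ η : FinConfig d, η.degree ≤ N → 0 ≤ f η)
    {η : FinConfig d} (hη : η.degree ≤ N) : 0 ≤ posGen g p c f η := by
  rw [posGen_eq hp hf]
  have h1 := exitRate_le hg hη
  refine add_nonneg (Finset.sum_nonneg fun x hx => mul_nonneg (hg.nonneg _) ?_)
    (mul_nonneg (by linarith) (h0 η hη))
  exact tsum_nonneg fun y =>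
    mul_nonneg (hp.nonneg _) (h0 _ ((degree_move hx y).trans_le hη))

/-- Attractivity: since `g` is non-decreasing, `L + c` preserves monotone functions. This is the
basic coupling in disguise: below `ζ`, the particles of `η` move together with those of `ζ`, and
the additional particles of `ζ` at `x` move at the additional rate `g(ζ(x)) - g(η(x))`. -/
theorem posGen_monotoneOn (hg : IsRate g) (hp : IsJumpLaw p) {f : FinConfig d → ℝ}
    (hf : LayerBdd f) {N : ℕ} {c : ℝ} (hc : N * g N ≤ c)
    (hm : MonotoneOn f {η | η.degree ≤ N}) :
    MonotoneOn (posGen g p c f) {η | η.degree ≤ N} := by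
  intro η hη ζ hζ hle
  have hη' : η.degree ≤ N := hη
  have hζ' : ζ.degree ≤ N := hζ
  have hsub : η.support ⊆ ζ.support := fun x hx => by
    rw [Finsupp.mem_support_iff] at hx ⊢
    have := hle x
    omega
  have hout : ∀ x ∈ ζ.support, x ∉ η.support → g (η x) = 0 := fun x _ hx => by
    rw [Finsupp.notMem_support_iff.1 hx, hg.zero]
  have e1 : ∑ x ∈ η.support, g (η x) * hopAvg p f η x
      = ∑ x ∈ ζ.support, g (η x) * hopAvg p f η x :=
    Finset.sum_subset hsub fun x h1 h2 => by rw [hout x h1 h2, zero_mul]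
  have e2 : exitRate g η = ∑ x ∈ ζ.support, g (η x) :=
    Finset.sum_subset hsub fun x h1 h2 => hout x h1 h2
  have hterm : ∀ x ∈ ζ.support, g (η x) * hopAvg p f η x + (g (ζ x) - g (η x)) * f η
      ≤ g (ζ x) * hopAvg p f ζ x := by
    intro x hx
    have h1 : g (η x) * hopAvg p f η x ≤ g (η x) * hopAvg p f ζ x := by
      by_cases hxη : x ∈ η.support
      · refine mul_le_mul_of_nonneg_left (hopAvg_le_hopAvg hp hf hf hxη hx fun y => ?_)
          (hg.nonneg _)
        exact hm ((degree_move hxη y).trans_le hη') ((degree_move hx y).trans_le hζ')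
          (move_mono hle x y)
      · rw [hout x hx hxη, zero_mul, zero_mul]
    -- If `η x = ζ x` the rates agree; otherwise `η` stays below `ζ` after the jump.
    have h2 : (g (ζ x) - g (η x)) * f η ≤ (g (ζ x) - g (η x)) * hopAvg p f ζ x := by
      rcases (hle x).eq_or_lt with h | h
      · rw [h, sub_self, zero_mul, zero_mul]
      · refine mul_le_mul_of_nonneg_left ?_ (sub_nonneg.2 (hg.mono h.le))
        rw [← hopAvg_const hp (f η) ζ x]
        exact hopAvg_le_hopAvg hp (.const _) hf hx hx fun y =>
          hm hη ((degree_move hx y).trans_le hζ') (le_move hle h y)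
    linarith
  have hsum := Finset.sum_le_sum hterm
  rw [Finset.sum_add_distrib, ← Finset.sum_mul, Finset.sum_sub_distrib, ← e1, ← e2] at hsum
  have hsum' : ∑ x ∈ η.support, g (η x) * hopAvg p f η x + (exitRate g ζ - exitRate g η) * f η
      ≤ ∑ x ∈ ζ.support, g (ζ x) * hopAvg p f ζ x := hsum
  have hlast : (c - exitRate g ζ) * f η ≤ (c - exitRate g ζ) * f ζ :=
    mul_le_mul_of_nonneg_left (hm hη hζ hle) (by linarith [exitRate_le hg hζ'])
  rw [posGen_eq hp hf, posGen_eq hp hf]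
  linarith

theorem semigroup_nonneg (hg : IsRate g) (hp : IsJumpLaw p) {f : FinConfig d → ℝ}
    (hf : LayerBdd f) {t : ℝ} (ht : 0 ≤ t) {N : ℕ}
    (h0 : ∀ η : FinConfig d, η.degree ≤ N → 0 ≤ f η) {η : FinConfig d} (hη : η.degree ≤ N) :
    0 ≤ semigroup g p t f η := by
  have h1 : ∀ (k : ℕ) (ξ : FinConfig d), ξ.degree ≤ N →
      0 ≤ ((posGen g p (N * g N))^[k] f) ξ := by
    intro k
    induction k with
    | zero => exact h0
    | succ k ih =>
      intro ξ hξ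
      rw [Function.iterate_succ_apply']
      exact posGen_nonneg hg hp (hf.posGen_iterate hg hp _ k) le_rfl ih hξ
  have h2 := (exp_mul_semigroup hg hp hf (N * g N) t η).nonneg fun k =>
    mul_nonneg (by positivity) (h1 k η hη)
  exact nonneg_of_mul_nonneg_right h2 (Real.exp_pos _)

theorem semigroup_monotone (hg : IsRate g) (hp : IsJumpLaw p) {f : FinConfig d → ℝ}
    (hf : LayerBdd f) (hm : Monotone f) {t : ℝ} (ht : 0 ≤ t) : Monotone (semigroup g p t f) := by
  intro η ζ hle
  set N := ζ.degree
  have hη : η.degree ≤ N := Finsupp.degree_mono hle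
  have h1 : ∀ k : ℕ, MonotoneOn ((posGen g p (N * g N))^[k] f) {η | η.degree ≤ N} := by
    intro k
    induction k with
    | zero => exact hm.monotoneOn _
    | succ k ih =>
      rw [Function.iterate_succ_apply']
      exact posGen_monotoneOn hg hp (hf.posGen_iterate hg hp _ k) le_rfl ih
  have h2 := hasSum_le (fun k => mul_le_mul_of_nonneg_left (h1 k hη (le_refl N) hle)
    (by positivity : 0 ≤ t ^ k / (k.factorial : ℝ)))
    (exp_mul_semigroup hg hp hf (N * g N) t η) (exp_mul_semigroup hg hp hf (N * g N) t ζ)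
  exact le_of_mul_le_mul_left h2 (Real.exp_pos _)

theorem generator_iterate_add (hg : IsRate g) (hp : IsJumpLaw p) {f h : FinConfig d → ℝ}
    (hf : LayerBdd f) (hh : LayerBdd h) (k : ℕ) :
    (generator g p)^[k] (f + h) = (generator g p)^[k] f + (generator g p)^[k] h := by
  induction k with
  | zero => rfl
  | succ k ih =>
    simp only [Function.iterate_succ_apply', ih]
    exact generator_add hp (hf.generator_iterate hg hp k) (hh.generator_iterate hg hp k)

theorem generator_iterate_smul (c : ℝ) (f : FinConfig d → ℝ) (k : ℕ) :
    (generator g p)^[k] (c • f) = c • (generator g p)^[k] f := by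
  induction k with
  | zero => rfl
  | succ k ih => simp only [Function.iterate_succ_apply', ih, generator_smul]

theorem semigroup_add (hg : IsRate g) (hp : IsJumpLaw p) {f h : FinConfig d → ℝ}
    (hf : LayerBdd f) (hh : LayerBdd h) (t : ℝ) (η : FinConfig d) :
    semigroup g p t (f + h) η = semigroup g p t f η + semigroup g p t h η := by
  rw [semigroup, semigroup, semigroup, ← (summable_semigroup hg hp hf t η).of_norm.tsum_add
    (summable_semigroup hg hp hh t η).of_norm]
  refine tsum_congr fun k => ?_
  rw [generator_iterate_add hg hp hf hh, Pi.add_apply, mul_add]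

theorem semigroup_smul (c : ℝ) (f : FinConfig d → ℝ) (t : ℝ) (η : FinConfig d) :
    semigroup g p t (c • f) η = c * semigroup g p t f η := by
  rw [semigroup, semigroup, ← tsum_mul_left]
  refine tsum_congr fun k => ?_
  rw [generator_iterate_smul, Pi.smul_apply, smul_eq_mul]
  ring

theorem generator_iterate_const (C : ℝ) {k : ℕ} (hk : k ≠ 0) :
    (generator g p)^[k] (fun _ => C) = 0 := by
  obtain ⟨k, rfl⟩ := Nat.exists_eq_succ_of_ne_zero hk
  rw [Function.iterate_succ_apply, generator_const]
  exact (Function.IsFixedPt.iterate (generator_const (g := g) (p := p) 0) k)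

theorem semigroup_const (C t : ℝ) (η : FinConfig d) : semigroup g p t (fun _ => C) η = C := by
  rw [semigroup, tsum_eq_single 0]
  · simp
  · intro k hk
    rw [generator_iterate_const C hk]
    simp

theorem semigroup_le_semigroup (hg : IsRate g) (hp : IsJumpLaw p) {f h : FinConfig d → ℝ}
    (hf : LayerBdd f) (hh : LayerBdd h) {t : ℝ} (ht : 0 ≤ t) (hle : ∀ η, f η ≤ h η)
    (η : FinConfig d) : semigroup g p t f η ≤ semigroup g p t h η := by
  have h1 : LayerBdd ((-1 : ℝ) • f) := hf.const_mul (-1)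
  have h2 := semigroup_nonneg hg hp (hh.add h1) ht
    (fun ξ _ => show 0 ≤ h ξ + -1 * f ξ by linarith [hle ξ]) (le_refl η.degree)
  rw [semigroup_add hg hp hh h1, semigroup_smul] at h2
  linarith

/-! ### Transition probabilities -/

/-- Dominated convergence for the powers of the generator. -/
theorem tendsto_generator_iterate (hg : IsRate g) (hp : IsJumpLaw p) {ι : Type*} {l : Filter ι}
    {F : ι → FinConfig d → ℝ} {f b : FinConfig d → ℝ} (hb : LayerBdd b)
    (hF : ∀ i η, |F i η| ≤ b η) (hf : ∀ η, |f η| ≤ b η)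
    (hlim : ∀ η, Tendsto (fun i => F i η) l (𝓝 (f η))) (k : ℕ) (η : FinConfig d) :
    Tendsto (fun i => ((generator g p)^[k] (F i)) η) l (𝓝 (((generator g p)^[k] f) η)) := by
  have hFb : ∀ i, LayerBdd (F i) := fun i N => by
    obtain ⟨C, hC⟩ := hb N
    exact ⟨C, fun η hη => (hF i η).trans ((le_abs_self _).trans (hC η hη))⟩
  have hfb : LayerBdd f := fun N => by
    obtain ⟨C, hC⟩ := hb N
    exact ⟨C, fun η hη => (hf η).trans ((le_abs_self _).trans (hC η hη))⟩
  induction k generalizing η with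
  | zero => exact hlim η
  | succ k ih =>
    simp only [Function.iterate_succ_apply']
    obtain ⟨C, hC⟩ := hb η.degree
    have hbd : ∀ i, ∀ ξ : FinConfig d, ξ.degree ≤ η.degree →
        |((generator g p)^[k] (F i)) ξ| ≤ (2 * (η.degree * g η.degree)) ^ k * C := fun i ξ hξ =>
      abs_generator_iterate_le hg hp (hFb i)
        (fun ζ hζ => (hF i ζ).trans ((le_abs_self _).trans (hC ζ hζ))) k hξ
    have e : ∀ i, generator g p ((generator g p)^[k] (F i)) η = _ := fun i =>
      generator_eq hp ((hFb i).generator_iterate hg hp k) η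
    simp only [e]
    rw [generator_eq hp (hfb.generator_iterate hg hp k)]
    refine tendsto_finsetSum _ fun x hx => ((Tendsto.sub ?_ (ih η)).const_mul _)
    refine tendsto_tsum_of_dominated_convergence
      ((hp.hasSum_sub x).summable.mul_right ((2 * (η.degree * g η.degree)) ^ k * C))
      (fun y => (ih _).const_mul _) (Eventually.of_forall fun i y => ?_)
    rw [Real.norm_eq_abs, abs_mul, abs_of_nonneg (hp.nonneg _)]
    exact mul_le_mul_of_nonneg_left (hbd i _ (degree_move hx y).le) (hp.nonneg _)

/-- Dominated convergence for the semigroup. -/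
theorem tendsto_semigroup (hg : IsRate g) (hp : IsJumpLaw p) {ι : Type*} {l : Filter ι}
    {F : ι → FinConfig d → ℝ} {f b : FinConfig d → ℝ} (hb : LayerBdd b)
    (hF : ∀ i η, |F i η| ≤ b η) (hf : ∀ η, |f η| ≤ b η)
    (hlim : ∀ η, Tendsto (fun i => F i η) l (𝓝 (f η))) (t : ℝ) (η : FinConfig d) :
    Tendsto (fun i => semigroup g p t (F i) η) l (𝓝 (semigroup g p t f η)) := by
  obtain ⟨C, hC⟩ := hb η.degree
  have hFC : ∀ i, ∀ ξ : FinConfig d, ξ.degree ≤ η.degree → |F i ξ| ≤ C := fun i ξ hξ =>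
    (hF i ξ).trans ((le_abs_self _).trans (hC ξ hξ))
  have hFb : ∀ i, LayerBdd (F i) := fun i N => by
    obtain ⟨C, hC⟩ := hb N
    exact ⟨C, fun η hη => (hF i η).trans ((le_abs_self _).trans (hC η hη))⟩
  refine tendsto_tsum_of_dominated_convergence
    ((Real.summable_pow_div_factorial (|t| * (2 * (η.degree * g η.degree)))).mul_right C)
    (fun k => (tendsto_generator_iterate hg hp hb hF hf hlim k η).const_mul _)
    (Eventually.of_forall fun i k => ?_)
  rw [Real.norm_eq_abs, abs_mul, abs_div, abs_pow, Nat.abs_cast, mul_pow]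
  calc _ ≤ |t| ^ k / (k.factorial : ℝ) * ((2 * (η.degree * g η.degree)) ^ k * C) :=
        mul_le_mul_of_nonneg_left (abs_generator_iterate_le hg hp (hFb i) (hFC i) k le_rfl)
          (by positivity)
    _ = _ := by ring

/-- The indicator function of a single configuration. -/
def point (ξ : FinConfig d) : FinConfig d → ℝ := Set.indicator {ξ} fun _ => 1

theorem point_apply (ξ η : FinConfig d) : point ξ η = if η = ξ then 1 else 0 := by
  simp [point, Set.indicator_apply]

theorem layerBdd_point (ξ : FinConfig d) : LayerBdd (point ξ) :=
  .of_bound 1 fun η => by rw [point_apply]; split_ifs <;> simp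

theorem sum_smul_point_apply (f : FinConfig d → ℝ) (s : Finset (FinConfig d)) (η : FinConfig d) :
    (∑ ξ ∈ s, f ξ • point ξ) η = if η ∈ s then f η else 0 := by
  simp [Finset.sum_apply, point_apply]

theorem layerBdd_smul_point (f : FinConfig d → ℝ) (ξ : FinConfig d) :
    LayerBdd (f ξ • point ξ) :=
  (layerBdd_point ξ).const_mul _

theorem layerBdd_sum_smul_point (f : FinConfig d → ℝ) (s : Finset (FinConfig d)) :
    LayerBdd (∑ ξ ∈ s, f ξ • point ξ) :=
  Submodule.sum_mem (layerSpace d) fun ξ _ =>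
    layerBdd_smul_point f ξ

theorem tendsto_sum_smul_point (f : FinConfig d → ℝ) (η : FinConfig d) :
    Tendsto (fun s : Finset (FinConfig d) => (∑ ξ ∈ s, f ξ • point ξ) η) atTop (𝓝 (f η)) := by
  refine tendsto_const_nhds.congr' ?_
  filter_upwards [eventually_ge_atTop {η}] with s hs
  rw [sum_smul_point_apply, if_pos (Finset.singleton_subset_iff.1 hs)]

theorem abs_sum_smul_point_le (f : FinConfig d → ℝ) (s : Finset (FinConfig d)) (η : FinConfig d) :
    |(∑ ξ ∈ s, f ξ • point ξ) η| ≤ |f η| := by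
  rw [sum_smul_point_apply]
  split_ifs <;> simp

theorem LayerBdd.abs {f : FinConfig d → ℝ} (hf : LayerBdd f) : LayerBdd fun η => |f η| :=
  fun N => by
    obtain ⟨C, hC⟩ := hf N
    exact ⟨C, fun η hη => (abs_abs _).trans_le (hC η hη)⟩

/-- The powers of `L` are given by kernels. -/
theorem hasSum_generator_iterate (hg : IsRate g) (hp : IsJumpLaw p) {f : FinConfig d → ℝ}
    (hf : LayerBdd f) (k : ℕ) (η : FinConfig d) :
    HasSum (fun ξ => f ξ * ((generator g p)^[k] (point ξ)) η) (((generator g p)^[k] f) η) := by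
  have h := tendsto_generator_iterate hg hp hf.abs (abs_sum_smul_point_le f) (fun _ => le_rfl)
    (tendsto_sum_smul_point f) k η
  refine h.congr fun s => ?_
  induction s using Finset.induction_on with
  | empty =>
    simpa using congrFun (generator_iterate_smul (g := g) (p := p) 0 0 k) η
  | insert ξ s hξ ih =>
    rw [Finset.sum_insert hξ, Finset.sum_insert hξ, generator_iterate_add hg hp
      (layerBdd_smul_point f ξ) (layerBdd_sum_smul_point f s), Pi.add_apply, ih,
      generator_iterate_smul, Pi.smul_apply, smul_eq_mul]

/-- `S(t)` is given by the transition probabilities. -/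
theorem hasSum_transitionProb (hg : IsRate g) (hp : IsJumpLaw p) {f : FinConfig d → ℝ}
    (hf : LayerBdd f) (t : ℝ) (η : FinConfig d) :
    HasSum (fun ξ => f ξ * transitionProb g p t η ξ) (semigroup g p t f η) := by
  have h := tendsto_semigroup hg hp hf.abs (abs_sum_smul_point_le f) (fun _ => le_rfl)
    (tendsto_sum_smul_point f) t η
  refine h.congr fun s => ?_
  induction s using Finset.induction_on with
  | empty =>
    exact (semigroup_const (g := g) (p := p) 0 t η).trans Finset.sum_empty.symm
  | insert ξ s hξ ih =>
    rw [Finset.sum_insert hξ, Finset.sum_insert hξ, semigroup_add hg hp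
      (layerBdd_smul_point f ξ) (layerBdd_sum_smul_point f s), ih, semigroup_smul]
    rfl

theorem transitionProb_nonneg (hg : IsRate g) (hp : IsJumpLaw p) {t : ℝ} (ht : 0 ≤ t)
    (η ξ : FinConfig d) : 0 ≤ transitionProb g p t η ξ :=
  semigroup_nonneg hg hp (layerBdd_point ξ) ht
    (fun ζ _ => by rw [point_apply]; split_ifs <;> simp) (le_refl η.degree)

/-! ### Duality with the process with reversed jumps -/

/-- The unnormalised one-site weight `w(k) φ^k`. -/
def siteWeight (g : ℕ → ℝ) (φ : ℝ) (k : ℕ) : ℝ := weight g k * φ ^ k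

theorem siteWeight_zero (φ : ℝ) : siteWeight g φ 0 = 1 := by
  simp [siteWeight, weight]

theorem siteWeight_pos (hg : IsRate g) {φ : ℝ} (hφ : 0 < φ) (k : ℕ) : 0 < siteWeight g φ k :=
  mul_pos (weight_pos hg k) (pow_pos hφ k)

theorem siteWeight_succ_mul (hg : IsRate g) (φ : ℝ) (k : ℕ) :
    siteWeight g φ (k + 1) * g (k + 1) = φ * siteWeight g φ k := by
  have h := (hg.pos (k + 1) (by omega)).ne'
  rw [siteWeight, siteWeight, weight, Finset.prod_Icc_succ_top (by omega), pow_succ, ← weight]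
  field_simp

/-- The weight `∏_x w(η(x)) φ^η(x)` of a finite configuration: the restriction of `μ_φ` to a
finite box is proportional to it. -/
def gibbs (g : ℕ → ℝ) (φ : ℝ) (η : FinConfig d) : ℝ := ∏ x ∈ η.support, siteWeight g φ (η x)

theorem gibbs_pos (hg : IsRate g) {φ : ℝ} (hφ : 0 < φ) (η : FinConfig d) : 0 < gibbs g φ η :=
  Finset.prod_pos fun _ _ => siteWeight_pos hg hφ _

theorem gibbs_eq_prod (φ : ℝ) {η : FinConfig d} {S : Finset (Site d)} (h : η.support ⊆ S) :
    gibbs g φ η = ∏ x ∈ S, siteWeight g φ (η x) :=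
  Finset.prod_subset h fun x _ hx => by
    rw [Finsupp.notMem_support_iff.1 hx, siteWeight_zero]

theorem gibbs_add_single_mul (hg : IsRate g) (φ : ℝ) (ω : FinConfig d) (x : Site d) :
    gibbs g φ (ω + Finsupp.single x 1) * g ((ω + Finsupp.single x 1 : FinConfig d) x)
      = φ * gibbs g φ ω := by
  have h1 : ω.support ⊆ insert x ω.support := Finset.subset_insert _ _
  have h2 : (ω + Finsupp.single x 1).support ⊆ insert x ω.support := by
    refine Finsupp.support_add.trans (Finset.union_subset h1 ?_)
    exact (Finsupp.support_single_subset).trans (by simp)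
  have hx : x ∈ insert x ω.support := Finset.mem_insert_self _ _
  rw [gibbs_eq_prod φ h1, gibbs_eq_prod φ h2, ← Finset.mul_prod_erase _ _ hx,
    ← Finset.mul_prod_erase _ _ hx]
  have h3 : ∏ y ∈ (insert x ω.support).erase x,
        siteWeight g φ ((ω + Finsupp.single x 1 : FinConfig d) y)
      = ∏ y ∈ (insert x ω.support).erase x, siteWeight g φ (ω y) :=
    Finset.prod_congr rfl fun y hy => by
      rw [Finsupp.add_apply, Finsupp.single_eq_of_ne (Finset.ne_of_mem_erase hy), add_zero]
  rw [h3, Finsupp.add_apply, Finsupp.single_eq_same, mul_right_comm, siteWeight_succ_mul hg]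
  ring

theorem move_eq_iff {ξ ζ : FinConfig d} {x y : Site d} (hy : y ∈ ζ.support) :
    move ξ x y = ζ ↔ ξ - Finsupp.single x 1 = ζ - Finsupp.single y 1 := by
  have h : Finsupp.single y 1 ≤ ζ := by
    rw [Finsupp.single_le_iff]
    exact Nat.one_le_iff_ne_zero.2 (Finsupp.mem_support_iff.1 hy)
  exact ⟨fun e => by rw [← e, move, add_tsub_cancel_right],
    fun e => by rw [move, e, tsub_add_cancel_of_le h]⟩

theorem gibbs_mul_rate (hg : IsRate g) (φ : ℝ) {ξ : FinConfig d} {x : Site d}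
    (hx : x ∈ ξ.support) :
    gibbs g φ ξ * g (ξ x) = φ * gibbs g φ (ξ - Finsupp.single x 1) := by
  have h : Finsupp.single x 1 ≤ ξ := by
    rw [Finsupp.single_le_iff]
    exact Nat.one_le_iff_ne_zero.2 (Finsupp.mem_support_iff.1 hx)
  have := gibbs_add_single_mul hg φ (ξ - Finsupp.single x 1) x
  rwa [tsub_add_cancel_of_le h] at this

/-- The jump law of the reversed process. -/
theorem IsJumpLaw.neg (hp : IsJumpLaw p) : IsJumpLaw fun z => p (-z) :=
  ⟨fun _ => hp.nonneg _, (Equiv.neg (Site d)).hasSum_iff.2 hp.hasSum⟩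

theorem hopAvg_point (p : Site d → ℝ) (ζ ξ : FinConfig d) (x : Site d) :
    hopAvg p (point ζ) ξ x = ∑ y ∈ ζ.support, p (y - x) * point ζ (move ξ x y) := by
  refine tsum_eq_sum fun y hy => ?_
  rw [point_apply, if_neg, mul_zero]
  rintro rfl
  refine hy (Finsupp.mem_support_iff.2 ?_)
  simp [move]

theorem gibbs_mul_generator_point (hg : IsRate g) (hp : IsJumpLaw p) (φ : ℝ)
    (ξ ζ : FinConfig d) :
    gibbs g φ ξ * generator g p (point ζ) ξ
      = gibbs g φ ζ * generator g (fun z => p (-z)) (point ξ) ζ := by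
  have e : ∀ {q : Site d → ℝ} (_ : IsJumpLaw q) (α β : FinConfig d),
      gibbs g φ α * generator g q (point β) α
        = ∑ x ∈ α.support, ∑ y ∈ β.support, gibbs g φ α * g (α x) *
            (q (y - x) * point β (move α x y)) - gibbs g φ α * (exitRate g α * point β α) := by
    intro q hq α β
    rw [generator_eq hq (layerBdd_point β), exitRate, Finset.sum_mul, Finset.mul_sum,
      Finset.mul_sum, ← Finset.sum_sub_distrib]
    refine Finset.sum_congr rfl fun x _ => ?_
    rw [hopAvg_point, ← Finset.mul_sum]
    ring
  rw [e hp, e hp.neg, Finset.sum_comm]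
  congr 1
  · refine Finset.sum_congr rfl fun y hy => Finset.sum_congr rfl fun x hx => ?_
    rw [gibbs_mul_rate hg φ hx, gibbs_mul_rate hg φ hy, point_apply, point_apply, neg_sub]
    by_cases h : ξ - Finsupp.single x 1 = ζ - Finsupp.single y 1
    · rw [if_pos ((move_eq_iff hy).2 h), if_pos ((move_eq_iff hx).2 h.symm), h]
    · rw [if_neg fun h' => h ((move_eq_iff hy).1 h'),
        if_neg fun h' => h ((move_eq_iff hx).1 h').symm]
      simp
  · rw [point_apply, point_apply]
    by_cases h : ξ = ζ
    · subst h; rfl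
    · rw [if_neg h, if_neg (Ne.symm h)]
      simp

theorem gibbs_mul_generator_iterate_point (hg : IsRate g) (hp : IsJumpLaw p) (φ : ℝ) (k : ℕ)
    (ξ ζ : FinConfig d) :
    gibbs g φ ξ * ((generator g p)^[k] (point ζ)) ξ
      = gibbs g φ ζ * ((generator g fun z => p (-z))^[k] (point ξ)) ζ := by
  -- In the inductive step, `L^(k+1) = L L^k` is expanded on one side and `L^k L` on the other, as a
  -- sum over the same intermediate configuration.
  induction k generalizing ξ ζ with
  | zero =>
    simp only [Function.iterate_zero, id_eq, point_apply]
    by_cases h : ξ = ζ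
    · subst h; rfl
    · rw [if_neg h, if_neg (Ne.symm h)]
      simp
  | succ k ih =>
    have h1 := (hasSum_generator_iterate hg hp
      ((layerBdd_point ζ).generator_iterate hg hp k) 1 ξ).mul_left (gibbs g φ ξ)
    have h2 := (hasSum_generator_iterate hg hp.neg
      ((layerBdd_point ξ).generator hg hp.neg) k ζ).mul_left (gibbs g φ ζ)
    rw [Function.iterate_succ_apply', Function.iterate_succ_apply]
    refine h1.unique (h2.congr_fun fun η => ?_)
    have e1 := gibbs_mul_generator_point hg hp φ ξ η
    have e2 := ih η ζ
    rw [Function.iterate_one]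
    linear_combination ((generator g p)^[k] (point ζ)) η * e1 +
      generator g (fun z => p (-z)) (point ξ) η * e2

/-- The zero-range process with reversed jumps is the adjoint of the process with respect to the
Gibbs weights. -/
theorem gibbs_mul_transitionProb (hg : IsRate g) (hp : IsJumpLaw p) (φ t : ℝ)
    (ξ ζ : FinConfig d) :
    gibbs g φ ξ * transitionProb g p t ξ ζ
      = gibbs g φ ζ * transitionProb g (fun z => p (-z)) t ζ ξ := by
  rw [transitionProb, transitionProb, semigroup, semigroup, ← tsum_mul_left, ← tsum_mul_left]
  refine tsum_congr fun k => ?_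
  have := gibbs_mul_generator_iterate_point hg hp φ k ξ ζ
  rw [point, point] at this
  linear_combination t ^ k / (k.factorial : ℝ) * this

/-! ### The FKG inequality -/

/-- Mathlib's lattice structure on `FinConfig d` is distributive. -/
instance instDistribLatticeFinConfig : DistribLattice (FinConfig d) where
  le_sup_inf a b c := fun x => by
    simp only [Finsupp.inf_apply, Finsupp.sup_apply]
    exact le_sup_inf

theorem tendsto_Iic_atTop :
    Tendsto (fun ξ : FinConfig d => Finset.Iic ξ) atTop atTop :=
  Monotone.tendsto_atTop_finset (fun _ _ h => Finset.Iic_subset_Iic.2 h)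
    fun ξ => ⟨ξ, Finset.mem_Iic.2 le_rfl⟩

/-- The FKG inequality for a log-supermodular weight on the countable lattice of finite
configurations, obtained from its finite version by exhaustion. -/
theorem tsum_mul_tsum_le_of_logSupermodular {m f h : FinConfig d → ℝ} (hm0 : ∀ a, 0 ≤ m a)
    (hm : Summable m) (hlat : ∀ a b, m a * m b ≤ m (a ⊓ b) * m (a ⊔ b))
    {A B : ℝ} (hf : Monotone f) (hf0 : ∀ a, 0 ≤ f a) (hfA : ∀ a, f a ≤ A)
    (hh : Monotone h) (hh0 : ∀ a, 0 ≤ h a) (hhB : ∀ a, h a ≤ B) :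
    (∑' a, m a * f a) * ∑' a, m a * h a ≤ (∑' a, m a) * ∑' a, m a * (f a * h a) := by
  have hlim : ∀ {F : FinConfig d → ℝ}, Summable F →
      Tendsto (fun ξ : FinConfig d => ∑ a ∈ Finset.Iic ξ, F a) atTop (𝓝 (∑' a, F a)) :=
    fun hF => hF.hasSum.comp tendsto_Iic_atTop
  have hs : ∀ {F : FinConfig d → ℝ} {C : ℝ}, (∀ a, 0 ≤ F a) → (∀ a, F a ≤ C) →
      Summable fun a => m a * F a := fun h0 hC =>
    Summable.of_nonneg_of_le (fun a => mul_nonneg (hm0 a) (h0 a))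
      (fun a => mul_le_mul_of_nonneg_left (hC a) (hm0 a)) (hm.mul_right _)
  have hfh : ∀ a, f a * h a ≤ A * B := fun a =>
    mul_le_mul (hfA a) (hhB a) (hh0 a) ((hf0 a).trans (hfA a))
  refine le_of_tendsto_of_tendsto' ((hlim (hs hf0 hfA)).mul (hlim (hs hh0 hhB)))
    ((hlim hm).mul (hlim (hs (fun a => mul_nonneg (hf0 a) (hh0 a)) hfh))) fun ξ => ?_
  have h4 := four_functions_theorem (fun a => m a * f a) (fun a => m a * h a) m
    (fun a => m a * (f a * h a)) (fun a => mul_nonneg (hm0 a) (hf0 a))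
    (fun a => mul_nonneg (hm0 a) (hh0 a)) hm0
    (fun a => mul_nonneg (hm0 a) (mul_nonneg (hf0 a) (hh0 a)))
    (fun a b => by
      have e1 : f a * h b ≤ f (a ⊔ b) * h (a ⊔ b) :=
        mul_le_mul (hf le_sup_left) (hh le_sup_right) (hh0 _) (hf0 _)
      calc m a * f a * (m b * h b) = m a * m b * (f a * h b) := by ring
        _ ≤ m (a ⊓ b) * m (a ⊔ b) * (f (a ⊔ b) * h (a ⊔ b)) :=
          mul_le_mul (hlat a b) e1 (mul_nonneg (hf0 _) (hh0 _))
            (mul_nonneg (hm0 _) (hm0 _))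
        _ = _ := by ring) (Finset.Iic ξ) (Finset.Iic ξ)
  refine h4.trans (mul_le_mul ?_ ?_ ?_ ?_)
  · refine Finset.sum_le_sum_of_subset_of_nonneg ?_ fun a _ _ => hm0 a
    exact Finset.infs_subset_iff.2 fun a ha b _ =>
      Finset.mem_Iic.2 (inf_le_left.trans (Finset.mem_Iic.1 ha))
  · refine Finset.sum_le_sum_of_subset_of_nonneg ?_ fun a _ _ =>
      mul_nonneg (hm0 a) (mul_nonneg (hf0 a) (hh0 a))
    exact Finset.sups_subset_iff.2 fun a ha b hb =>
      Finset.mem_Iic.2 (sup_le (Finset.mem_Iic.1 ha) (Finset.mem_Iic.1 hb))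
  · exact Finset.sum_nonneg fun a _ => mul_nonneg (hm0 a) (mul_nonneg (hf0 a) (hh0 a))
  · exact Finset.sum_nonneg fun a _ => hm0 a

theorem gibbs_mul_gibbs (φ : ℝ) (a b : FinConfig d) :
    gibbs g φ a * gibbs g φ b = gibbs g φ (a ⊓ b) * gibbs g φ (a ⊔ b) := by
  have ha : a.support ⊆ (a ⊔ b).support := fun x => by
    simp only [Finsupp.mem_support_iff, Finsupp.sup_apply]
    intro h1 h2
    exact h1 (Nat.le_zero.1 (le_sup_left.trans h2.le))
  have hb : b.support ⊆ (a ⊔ b).support := fun x => by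
    simp only [Finsupp.mem_support_iff, Finsupp.sup_apply]
    intro h1 h2
    exact h1 (Nat.le_zero.1 (le_sup_right.trans h2.le))
  have hi : (a ⊓ b).support ⊆ (a ⊔ b).support := fun x hx => ha (by
    simp only [Finsupp.mem_support_iff, Finsupp.inf_apply] at hx ⊢
    intro h
    exact hx (Nat.le_zero.1 (inf_le_left.trans h.le)))
  rw [gibbs_eq_prod φ ha, gibbs_eq_prod φ hb, gibbs_eq_prod φ hi, gibbs,
    ← Finset.prod_mul_distrib, ← Finset.prod_mul_distrib]
  refine Finset.prod_congr rfl fun x _ => ?_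
  rw [Finsupp.inf_apply, Finsupp.sup_apply]
  rcases le_total (a x) (b x) with h | h
  · rw [inf_eq_left.2 h, sup_eq_right.2 h]
  · rw [inf_eq_right.2 h, sup_eq_left.2 h, mul_comm]

/-! ### Laws on finite configurations -/

instance instDiscreteFinConfig : DiscreteMeasurableSpace (FinConfig d) :=
  ⟨fun _ => trivial⟩

/-- Remove all particles outside the finite set `Λ`. -/
def restr (Λ : Finset (Site d)) (η : Config d) : FinConfig d :=
  Finsupp.indicator Λ fun x _ => η x

theorem restr_apply (Λ : Finset (Site d)) (η : Config d) (x : Site d) :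
    restr Λ η x = if x ∈ Λ then η x else 0 := by
  simp [restr, Finsupp.indicator_apply]

theorem support_restr_subset (Λ : Finset (Site d)) (η : Config d) : (restr Λ η).support ⊆ Λ :=
  fun x hx => by
    by_contra h
    rw [Finsupp.mem_support_iff, restr_apply, if_neg h] at hx
    exact hx rfl

theorem restr_eq_iff {Λ : Finset (Site d)} {η : Config d} {ξ : FinConfig d} :
    restr Λ η = ξ ↔ ξ.support ⊆ Λ ∧ ∀ x ∈ Λ, η x = ξ x := by
  constructor
  · rintro rfl
    exact ⟨support_restr_subset Λ η, fun x hx => by rw [restr_apply, if_pos hx]⟩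
  · rintro ⟨h1, h2⟩
    ext x
    rw [restr_apply]
    split_ifs with hx
    · exact h2 x hx
    · exact (Finsupp.notMem_support_iff.1 fun h => hx (h1 h)).symm

theorem restr_restr {A M : Finset (Site d)} (h : A ⊆ M) (η : Config d) :
    restr A (restr M η : FinConfig d) = restr A η := by
  ext x
  simp only [restr_apply]
  split_ifs with h1 h2
  · rfl
  · exact absurd (h h1) h2
  · rfl

theorem restr_mono {Λ Λ' : Finset (Site d)} (h : Λ ⊆ Λ') (η : Config d) :
    restr Λ η ≤ restr Λ' η := fun x => by
  rw [restr_apply, restr_apply]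
  split_ifs with h1 h2 h2
  · exact le_rfl
  · exact absurd (h h1) h2
  · exact Nat.zero_le _
  · exact le_rfl

theorem measurable_restr (Λ : Finset (Site d)) : Measurable (restr Λ : Config d → FinConfig d) := by
  refine measurable_to_countable' fun ξ => ?_
  have : restr Λ ⁻¹' {ξ} = {η : Config d | ξ.support ⊆ Λ ∧ ∀ x ∈ Λ, η x = ξ x} := by
    ext η
    exact restr_eq_iff
  rw [this]
  refine (MeasurableSet.const _).inter ?_
  have : {η : Config d | ∀ x ∈ Λ, η x = ξ x} = ⋂ x ∈ Λ, (fun η : Config d => η x) ⁻¹' {ξ x} := by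
    ext η
    simp
  change MeasurableSet {η : Config d | ∀ x ∈ Λ, η x = ξ x}
  rw [this]
  exact Finset.measurableSet_biInter _ fun x _ => measurable_pi_apply x (measurableSet_singleton _)

theorem lintegral_lawAt (g : ℕ → ℝ) (p : Site d → ℝ) (t : ℝ) (η : FinConfig d)
    (F : FinConfig d → ENNReal) :
    ∫⁻ ξ, F ξ ∂(lawAt g p t η) = ∑' ξ, ENNReal.ofReal (transitionProb g p t η ξ) * F ξ := by
  rw [lawAt, lintegral_sum_measure]
  exact tsum_congr fun ξ => by rw [lintegral_smul_measure, lintegral_dirac, smul_eq_mul]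

theorem lintegral_lawAt_ofReal (hg : IsRate g) (hp : IsJumpLaw p) {t : ℝ} (ht : 0 ≤ t)
    {f : FinConfig d → ℝ} (hf : LayerBdd f) (hf0 : ∀ ξ, 0 ≤ f ξ) (η : FinConfig d) :
    ∫⁻ ξ, ENNReal.ofReal (f ξ) ∂(lawAt g p t η) = ENNReal.ofReal (semigroup g p t f η) := by
  have h := hasSum_transitionProb hg hp hf t η
  rw [lintegral_lawAt, ← h.tsum_eq, ENNReal.ofReal_tsum_of_nonneg
    (fun ξ => mul_nonneg (hf0 ξ) (transitionProb_nonneg hg hp ht η ξ)) h.summable]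
  exact tsum_congr fun ξ => by
    rw [mul_comm, ← ENNReal.ofReal_mul (hf0 ξ)]

theorem isProbabilityMeasure_lawAt (hg : IsRate g) (hp : IsJumpLaw p) {t : ℝ} (ht : 0 ≤ t)
    (η : FinConfig d) : IsProbabilityMeasure (lawAt g p t η) := by
  have h := lintegral_lawAt_ofReal hg hp ht (.const 1) (fun _ => zero_le_one) η
  rw [semigroup_const] at h
  exact ⟨by simpa using h⟩

/-- The normalising constant `z(φ)`. -/
def partitionFn (g : ℕ → ℝ) (φ : ℝ) : ℝ := ∑' k, siteWeight g φ k

theorem partitionFn_pos (hg : IsRate g) {φ : ℝ} (hφ : 0 < φ) : 0 < partitionFn g φ :=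
  (summable_weight hg hφ).tsum_pos (fun k => (siteWeight_pos hg hφ k).le) 0
    (siteWeight_pos hg hφ 0)

theorem sitePMF_apply (hg : IsRate g) {φ : ℝ} (hφ : 0 < φ) (k : ℕ) :
    sitePMF hg hφ k = ENNReal.ofReal (siteWeight g φ k / partitionFn g φ) := by
  rw [sitePMF, PMF.normalize_apply, ENNReal.ofReal_div_of_pos (partitionFn_pos hg hφ),
    ENNReal.div_eq_inv_mul, mul_comm, partitionFn,
    ENNReal.ofReal_tsum_of_nonneg (fun k => (siteWeight_pos hg hφ k).le) (summable_weight hg hφ)]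
  rfl

/-- The probability of `ξ` under `μ_φ` restricted to `Λ`. -/
def boxProb (g : ℕ → ℝ) (φ : ℝ) (Λ : Finset (Site d)) (ξ : FinConfig d) : ℝ :=
  if ξ.support ⊆ Λ then gibbs g φ ξ / partitionFn g φ ^ Λ.card else 0

theorem boxProb_nonneg (hg : IsRate g) {φ : ℝ} (hφ : 0 < φ) (Λ : Finset (Site d))
    (ξ : FinConfig d) : 0 ≤ boxProb g φ Λ ξ := by
  rw [boxProb]
  split_ifs
  · exact div_nonneg (gibbs_pos hg hφ ξ).le (pow_pos (partitionFn_pos hg hφ) _).le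
  · exact le_rfl

/-- The law of the restriction to `Λ` of a configuration with law `μ_φ`. -/
def boxLaw (hg : IsRate g) {φ : ℝ} (hφ : 0 < φ) (Λ : Finset (Site d)) : Measure (FinConfig d) :=
  (fugacityMeasure d hg hφ : Measure (Config d)).map (restr Λ)

instance (hg : IsRate g) {φ : ℝ} (hφ : 0 < φ) (Λ : Finset (Site d)) :
    IsProbabilityMeasure (boxLaw hg hφ Λ) :=
  Measure.isProbabilityMeasure_map (measurable_restr Λ).aemeasurable

theorem lintegral_boxLaw (hg : IsRate g) {φ : ℝ} (hφ : 0 < φ) (Λ : Finset (Site d))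
    (F : FinConfig d → ENNReal) :
    ∫⁻ ξ, F ξ ∂(boxLaw hg hφ Λ)
      = ∫⁻ η, F (restr Λ η) ∂(fugacityMeasure d hg hφ : Measure (Config d)) :=
  lintegral_map .of_discrete (measurable_restr Λ)

theorem boxLaw_singleton (hg : IsRate g) {φ : ℝ} (hφ : 0 < φ) (Λ : Finset (Site d))
    (ξ : FinConfig d) : boxLaw hg hφ Λ {ξ} = ENNReal.ofReal (boxProb g φ Λ ξ) := by
  rw [boxLaw, Measure.map_apply (measurable_restr Λ) (measurableSet_singleton _), boxProb]
  split_ifs with h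
  · have e : restr Λ ⁻¹' {ξ} = (Λ : Set (Site d)).pi fun x => ({ξ x} : Set ℕ) := by
      ext η
      simp [restr_eq_iff, h, Set.mem_pi]
    rw [e, fugacityMeasure, ProbabilityMeasure.coe_mk, Measure.infinitePi_pi _
      fun x _ => measurableSet_singleton _]
    have e2 : ∀ x ∈ Λ, (sitePMF hg hφ).toMeasure {ξ x}
        = ENNReal.ofReal (siteWeight g φ (ξ x) / partitionFn g φ) := fun x _ => by
      rw [PMF.toMeasure_apply_singleton _ _ (measurableSet_singleton _), sitePMF_apply]
    rw [Finset.prod_congr rfl e2, ← ENNReal.ofReal_prod_of_nonneg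
      fun x _ => (div_pos (siteWeight_pos hg hφ _) (partitionFn_pos hg hφ)).le,
      Finset.prod_div_distrib, Finset.prod_const, gibbs_eq_prod φ h]
  · have e : restr Λ ⁻¹' {ξ} = ∅ := by
      ext η
      simp [restr_eq_iff, h]
    rw [e, measure_empty, ENNReal.ofReal_zero]

theorem hasSum_boxProb (hg : IsRate g) {φ : ℝ} (hφ : 0 < φ) (Λ : Finset (Site d)) :
    HasSum (boxProb g φ Λ) 1 := by
  have h1 : ∑' ξ, ENNReal.ofReal (boxProb g φ Λ ξ) = 1 := by
    have h := lintegral_countable' (μ := boxLaw hg hφ Λ) (fun _ => 1)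
    simp only [lintegral_const, measure_univ, one_mul, boxLaw_singleton] at h
    exact h.symm
  have h2 : Summable (boxProb g φ Λ) := by
    have := ENNReal.summable_toReal (h1.trans_ne ENNReal.one_ne_top)
    exact this.congr fun ξ => (ENNReal.toReal_ofReal (boxProb_nonneg hg hφ Λ ξ))
  rw [← ENNReal.ofReal_tsum_of_nonneg (boxProb_nonneg hg hφ Λ) h2, ENNReal.ofReal_eq_one] at h1
  exact h1 ▸ h2.hasSum

/-- The law at time `t` of the process started from `μ_φ` restricted to `Λ`. -/
def evolved (hg : IsRate g) {φ : ℝ} (hφ : 0 < φ) (p : Site d → ℝ) (Λ : Finset (Site d)) (t : ℝ) :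
    Measure (FinConfig d) :=
  evolveFin g p t (boxLaw hg hφ Λ)

theorem isProbabilityMeasure_evolved (hg : IsRate g) {φ : ℝ} (hφ : 0 < φ) (hp : IsJumpLaw p)
    (Λ : Finset (Site d)) {t : ℝ} (ht : 0 ≤ t) :
    IsProbabilityMeasure (evolved hg hφ p Λ t) :=
  isProbabilityMeasure_bind (Measurable.of_discrete.aemeasurable)
    (Eventually.of_forall fun η => isProbabilityMeasure_lawAt hg hp ht η)

theorem lintegral_evolved (hg : IsRate g) {φ : ℝ} (hφ : 0 < φ) (hp : IsJumpLaw p)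
    (Λ : Finset (Site d)) {t : ℝ} (ht : 0 ≤ t) {f : FinConfig d → ℝ} (hf : LayerBdd f)
    (hf0 : ∀ ξ, 0 ≤ f ξ) :
    ∫⁻ ξ, ENNReal.ofReal (f ξ) ∂(evolved hg hφ p Λ t)
      = ∫⁻ ξ, ENNReal.ofReal (semigroup g p t f ξ) ∂(boxLaw hg hφ Λ) := by
  rw [evolved, evolveFin, Measure.lintegral_bind Measurable.of_discrete.aemeasurable
    Measurable.of_discrete.aemeasurable]
  exact lintegral_congr fun η => lintegral_lawAt_ofReal hg hp ht hf hf0 η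

/-! ### Stochastic domination by `μ_φ` -/

/-- The indicator function of having a particle outside `Λ`. -/
def escape (Λ : Finset (Site d)) (ξ : FinConfig d) : ℝ :=
  open Classical in if ξ.support ⊆ Λ then 0 else 1

theorem escape_nonneg (Λ : Finset (Site d)) (ξ : FinConfig d) : 0 ≤ escape Λ ξ := by
  rw [escape]; split_ifs <;> simp

theorem escape_le_one (Λ : Finset (Site d)) (ξ : FinConfig d) : escape Λ ξ ≤ 1 := by
  rw [escape]; split_ifs <;> simp

theorem layerBdd_escape (Λ : Finset (Site d)) : LayerBdd (escape Λ) :=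
  .of_bound 1 fun ξ => abs_le.2 ⟨by linarith [escape_nonneg Λ ξ], escape_le_one Λ ξ⟩

theorem monotone_escape (Λ : Finset (Site d)) : Monotone (escape Λ) := by
  intro a b hab
  by_cases h : b.support ⊆ Λ
  · have h' : a.support ⊆ Λ := fun x hx => h (by
      rw [Finsupp.mem_support_iff] at hx ⊢
      have := hab x
      omega)
    rw [escape, escape, if_pos h, if_pos h']
  · rw [show escape Λ b = 1 from if_neg h]
    exact escape_le_one Λ a

/-- The probability that the process with reversed jumps has a particle outside `Λ` at time `t`. -/
def escapeProb (g : ℕ → ℝ) (p : Site d → ℝ) (t : ℝ) (Λ : Finset (Site d)) :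
    FinConfig d → ℝ :=
  semigroup g (fun z => p (-z)) t (escape Λ)

theorem escapeProb_nonneg (hg : IsRate g) (hp : IsJumpLaw p) {t : ℝ} (ht : 0 ≤ t)
    (Λ : Finset (Site d)) (ξ : FinConfig d) : 0 ≤ escapeProb g p t Λ ξ :=
  semigroup_nonneg hg hp.neg (layerBdd_escape Λ) ht (fun ξ _ => escape_nonneg Λ ξ)
    (le_refl ξ.degree)

theorem escapeProb_le_one (hg : IsRate g) (hp : IsJumpLaw p) {t : ℝ} (ht : 0 ≤ t)
    (Λ : Finset (Site d)) (ξ : FinConfig d) : escapeProb g p t Λ ξ ≤ 1 :=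
  (semigroup_le_semigroup hg hp.neg (layerBdd_escape Λ) (.const 1) ht (escape_le_one Λ) ξ).trans_eq
    (semigroup_const 1 t ξ)

/-- By duality, the density of the evolved law with respect to the Gibbs weights is proportional
to the probability that the process with reversed jumps is inside `Λ` at time `t`. -/
theorem evolved_singleton (hg : IsRate g) {φ : ℝ} (hφ : 0 < φ) (hp : IsJumpLaw p)
    (Λ : Finset (Site d)) {t : ℝ} (ht : 0 ≤ t) (ζ : FinConfig d) :
    evolved hg hφ p Λ t {ζ} = ENNReal.ofReal
      (gibbs g φ ζ / partitionFn g φ ^ Λ.card * (1 - escapeProb g p t Λ ζ)) := by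
  have hz := pow_pos (partitionFn_pos hg hφ) Λ.card
  have h0 : ∀ ξ, 0 ≤ point ζ ξ := fun ξ => by rw [point_apply]; split_ifs <;> simp
  have h1 : evolved hg hφ p Λ t {ζ} = ∫⁻ ξ, ENNReal.ofReal (point ζ ξ) ∂(evolved hg hφ p Λ t) := by
    rw [← lintegral_indicator_one (measurableSet_singleton ζ)]
    refine lintegral_congr fun ξ => ?_
    rw [point_apply, Set.indicator_apply]
    by_cases h : ξ = ζ <;> simp [h]
  have h2 : HasSum (fun ξ => transitionProb g p t ξ ζ * boxProb g φ Λ ξ)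
      (gibbs g φ ζ / partitionFn g φ ^ Λ.card * (1 - escapeProb g p t Λ ζ)) := by
    have e1 := hasSum_transitionProb hg hp.neg (.const 1) t ζ
    have e2 := hasSum_transitionProb hg hp.neg (layerBdd_escape Λ) t ζ
    rw [semigroup_const] at e1
    refine ((e1.sub e2).mul_left (gibbs g φ ζ / partitionFn g φ ^ Λ.card)).congr_fun fun ξ => ?_
    have e3 := gibbs_mul_transitionProb hg hp φ t ξ ζ
    rw [boxProb, escape]
    split_ifs
    · field_simp
      linear_combination e3
    · ring
  rw [h1, lintegral_evolved hg hφ hp Λ ht (layerBdd_point ζ) h0, lintegral_countable', ← h2.tsum_eq,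
    ENNReal.ofReal_tsum_of_nonneg (fun ξ => mul_nonneg (transitionProb_nonneg hg hp ht _ _)
      (boxProb_nonneg hg hφ Λ ξ)) h2.summable]
  exact tsum_congr fun ξ => by
    rw [boxLaw_singleton, ENNReal.ofReal_mul (transitionProb_nonneg hg hp ht _ _)]
    rfl

theorem boxProb_logSupermodular (φ : ℝ) (hg : IsRate g) (hφ : 0 < φ) (Λ : Finset (Site d))
    (a b : FinConfig d) :
    boxProb g φ Λ a * boxProb g φ Λ b ≤ boxProb g φ Λ (a ⊓ b) * boxProb g φ Λ (a ⊔ b) := by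
  by_cases h : a.support ⊆ Λ ∧ b.support ⊆ Λ
  · have hs : (a ⊔ b).support ⊆ Λ := by
      intro x hx
      rw [Finsupp.mem_support_iff, Finsupp.sup_apply] at hx
      by_contra hc
      have h1 := Finsupp.notMem_support_iff.1 fun h' => hc (h.1 h')
      have h2 := Finsupp.notMem_support_iff.1 fun h' => hc (h.2 h')
      exact hx (by rw [h1, h2]; rfl)
    have hi : (a ⊓ b).support ⊆ Λ := by
      intro x hx
      rw [Finsupp.mem_support_iff, Finsupp.inf_apply] at hx
      by_contra hc
      have h1 := Finsupp.notMem_support_iff.1 fun h' => hc (h.1 h')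
      exact hx (by rw [h1]; exact Nat.zero_min _)
    rw [boxProb, boxProb, boxProb, boxProb, if_pos h.1, if_pos h.2, if_pos hs, if_pos hi,
      div_mul_div_comm, div_mul_div_comm, gibbs_mul_gibbs]
  · have h0 : boxProb g φ Λ a * boxProb g φ Λ b = 0 := by
      rw [not_and_or] at h
      rcases h with h | h
      · rw [boxProb, if_neg h, zero_mul]
      · rw [mul_comm, boxProb, if_neg h, zero_mul]
    rw [h0]
    exact mul_nonneg (boxProb_nonneg hg hφ Λ _) (boxProb_nonneg hg hφ Λ _)

/-- Domination for bounded functions: the density `1 - escapeProb` is decreasing by attractivity of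
the process with reversed jumps, so the FKG inequality in a large box `M` applies. -/
theorem lintegral_evolved_le_of_bounded (hg : IsRate g) {φ : ℝ} (hφ : 0 < φ) (hp : IsJumpLaw p)
    (Λ A : Finset (Site d)) {t : ℝ} (ht : 0 ≤ t) {f : FinConfig d → ℝ} (hf : Monotone f)
    (hf0 : ∀ ξ, 0 ≤ f ξ) {C : ℝ} (hC : ∀ ξ, f ξ ≤ C) (hA : ∀ ξ : FinConfig d, f (restr A ξ) = f ξ) :
    ∫⁻ ξ, ENNReal.ofReal (f ξ) ∂(evolved hg hφ p Λ t)
      ≤ ∫⁻ ξ, ENNReal.ofReal (f ξ) ∂(boxLaw hg hφ A) := by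
  set k := escapeProb g p t Λ with hk
  have hk0 := escapeProb_nonneg hg hp ht Λ
  have hk1 := escapeProb_le_one hg hp ht Λ
  have hz : ∀ n : ℕ, 0 < partitionFn g φ ^ n := fun n => pow_pos (partitionFn_pos hg hφ) n
  set r : FinConfig d → ℝ := fun ζ => gibbs g φ ζ / partitionFn g φ ^ Λ.card * (1 - k ζ) with hr
  have hr0 : ∀ ζ, 0 ≤ r ζ := fun ζ =>
    mul_nonneg (div_pos (gibbs_pos hg hφ ζ) (hz _)).le (sub_nonneg.2 (hk1 ζ))
  have hr1 : ∑' ζ, ENNReal.ofReal (r ζ) = 1 := by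
    have := isProbabilityMeasure_evolved hg hφ hp Λ ht
    have h := lintegral_countable' (μ := evolved hg hφ p Λ t) (fun _ => 1)
    simp only [lintegral_const, measure_univ, one_mul, evolved_singleton hg hφ hp Λ ht] at h
    exact h.symm
  rw [lintegral_countable']
  simp only [evolved_singleton hg hφ hp Λ ht]
  refine ENNReal.summable.tsum_le_of_sum_le fun s => ?_
  -- It suffices to bound finite sums; these only involve configurations inside a finite set `M`,
  -- where the law `boxProb g φ M` is available as a reference.
  set M : Finset (Site d) := A ∪ s.biUnion fun ζ => ζ.support with hM
  have hAM : A ⊆ M := Finset.subset_union_left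
  have hsM : ∀ ζ ∈ s, ζ.support ⊆ M := fun ζ hζ =>
    (Finset.subset_biUnion_of_mem (fun ζ : FinConfig d => ζ.support) hζ).trans
      Finset.subset_union_right
  set m := boxProb g φ M with hm
  have hm0 := boxProb_nonneg hg hφ M
  have hm1 : HasSum m 1 := hasSum_boxProb hg hφ M
  have hsum : ∀ {F : FinConfig d → ℝ} {B : ℝ}, (∀ a, 0 ≤ F a) → (∀ a, F a ≤ B) →
      Summable fun a => m a * F a := fun h0 hB =>
    Summable.of_nonneg_of_le (fun a => mul_nonneg (hm0 a) (h0 a))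
      (fun a => mul_le_mul_of_nonneg_left (hB a) (hm0 a)) (hm1.summable.mul_right _)
  have s1 := hsum hf0 hC
  have s2 := hsum hk0 hk1
  have s3 : Summable fun a => m a * (f a * k a) := hsum (B := C)
    (fun a => mul_nonneg (hf0 a) (hk0 a))
    (fun a => (mul_le_mul (hC a) (hk1 a) (hk0 a) ((hf0 a).trans (hC a))).trans_eq (mul_one C))
  -- FKG for the increasing functions `f` and `k = escapeProb`.
  have fkg := tsum_mul_tsum_le_of_logSupermodular hm0 hm1.summable
    (boxProb_logSupermodular φ hg hφ M) hf hf0 hC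
    (semigroup_monotone hg hp.neg (layerBdd_escape Λ) (monotone_escape Λ) ht) hk0 hk1
  rw [hm1.tsum_eq, one_mul] at fkg
  set κ : ℝ := partitionFn g φ ^ M.card / partitionFn g φ ^ Λ.card with hκ
  have hκ0 : 0 < κ := div_pos (hz _) (hz _)
  have hrm : ∀ ζ : FinConfig d, ζ.support ⊆ M → r ζ = κ * (m ζ * (1 - k ζ)) := fun ζ hζ => by
    have e1 := (hz M.card).ne'
    have e2 := (hz Λ.card).ne'
    rw [hr, hm, boxProb, if_pos hζ, hκ]
    field_simp
  have hrm' : ∀ ζ : FinConfig d, κ * (m ζ * (1 - k ζ)) ≤ r ζ := fun ζ => by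
    by_cases hζ : ζ.support ⊆ M
    · exact (hrm ζ hζ).ge
    · rw [hm, boxProb, if_neg hζ, zero_mul, mul_zero]
      exact hr0 ζ
  -- The evolved law gives mass at most one to the configurations inside `M`.
  have hmass : κ * (1 - ∑' ζ, m ζ * k ζ) ≤ 1 := by
    have e1 : HasSum (fun ζ => κ * (m ζ * (1 - k ζ))) (κ * (1 - ∑' ζ, m ζ * k ζ)) :=
      ((hm1.sub s2.hasSum).congr_fun fun ζ => by ring).mul_left κ
    have e2 : Summable r := by
      have := ENNReal.summable_toReal (hr1.trans_ne ENNReal.one_ne_top)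
      exact this.congr fun ξ => (ENNReal.toReal_ofReal (hr0 ξ))
    rw [← ENNReal.ofReal_tsum_of_nonneg hr0 e2, ENNReal.ofReal_eq_one] at hr1
    exact (hasSum_le hrm' e1 e2.hasSum).trans_eq hr1
  have hE0 : 0 ≤ ∑' ζ, m ζ * f ζ := tsum_nonneg fun ζ => mul_nonneg (hm0 ζ) (hf0 ζ)
  have hmain : ∑ ζ ∈ s, f ζ * r ζ ≤ ∑' ζ, m ζ * f ζ := by
    have e1 : HasSum (fun ζ => κ * (m ζ * f ζ * (1 - k ζ)))
        (κ * (∑' ζ, m ζ * f ζ - ∑' ζ, m ζ * (f ζ * k ζ))) :=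
      ((s1.hasSum.sub s3.hasSum).congr_fun fun ζ => by ring).mul_left κ
    have e2 : ∑ ζ ∈ s, f ζ * r ζ = ∑ ζ ∈ s, κ * (m ζ * f ζ * (1 - k ζ)) :=
      Finset.sum_congr rfl fun ζ hζ => by rw [hrm ζ (hsM ζ hζ)]; ring
    rw [e2]
    refine (sum_le_hasSum s (fun ζ _ => mul_nonneg hκ0.le (mul_nonneg
      (mul_nonneg (hm0 ζ) (hf0 ζ)) (sub_nonneg.2 (hk1 ζ)))) e1).trans ?_
    calc κ * (∑' ζ, m ζ * f ζ - ∑' ζ, m ζ * (f ζ * k ζ))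
        ≤ κ * (∑' ζ, m ζ * f ζ - (∑' ζ, m ζ * f ζ) * ∑' ζ, m ζ * k ζ) :=
          mul_le_mul_of_nonneg_left (sub_le_sub_left fkg _) hκ0.le
      _ = (κ * (1 - ∑' ζ, m ζ * k ζ)) * ∑' ζ, m ζ * f ζ := by ring
      _ ≤ 1 * ∑' ζ, m ζ * f ζ := mul_le_mul_of_nonneg_right hmass hE0
      _ = _ := one_mul _
  have hAM' : ∫⁻ ξ, ENNReal.ofReal (f ξ) ∂(boxLaw hg hφ A)
      = ENNReal.ofReal (∑' ζ, m ζ * f ζ) := by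
    have e : ∫⁻ ξ, ENNReal.ofReal (f ξ) ∂(boxLaw hg hφ A)
        = ∫⁻ ξ, ENNReal.ofReal (f ξ) ∂(boxLaw hg hφ M) := by
      rw [lintegral_boxLaw, lintegral_boxLaw]
      refine lintegral_congr fun η => ?_
      rw [← hA (restr M η), restr_restr hAM]
    rw [e, lintegral_countable', ENNReal.ofReal_tsum_of_nonneg
      (fun ζ => mul_nonneg (hm0 ζ) (hf0 ζ)) s1]
    exact tsum_congr fun ζ => by
      rw [boxLaw_singleton, mul_comm, ← ENNReal.ofReal_mul (hm0 ζ)]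
  rw [hAM', Finset.sum_congr rfl fun ζ _ => (ENNReal.ofReal_mul (hf0 ζ)).symm,
    ← ENNReal.ofReal_sum_of_nonneg fun ζ _ => mul_nonneg (hf0 ζ) (hr0 ζ)]
  exact ENNReal.ofReal_le_ofReal hmain

/-- The process started from the restriction of `μ_φ` to a finite set stays stochastically below
`μ_φ`. -/
theorem lintegral_evolved_le (hg : IsRate g) {φ : ℝ} (hφ : 0 < φ) (hp : IsJumpLaw p)
    (Λ A : Finset (Site d)) {t : ℝ} (ht : 0 ≤ t) {f : FinConfig d → ℝ} (hf : Monotone f)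
    (hf0 : ∀ ξ, 0 ≤ f ξ) (hA : ∀ ξ : FinConfig d, f (restr A ξ) = f ξ) :
    ∫⁻ ξ, ENNReal.ofReal (f ξ) ∂(evolved hg hφ p Λ t)
      ≤ ∫⁻ ξ, ENNReal.ofReal (f ξ) ∂(boxLaw hg hφ A) := by
  have h1 : ∀ ξ, ENNReal.ofReal (f ξ) = ⨆ n : ℕ, ENNReal.ofReal (min (f ξ) n) := by
    intro ξ
    refine le_antisymm ?_ (iSup_le fun n => ENNReal.ofReal_le_ofReal (min_le_left _ _))
    obtain ⟨n, hn⟩ := exists_nat_ge (f ξ)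
    exact le_iSup_of_le n (by rw [min_eq_left hn])
  rw [lintegral_congr h1, lintegral_iSup (f := fun (n : ℕ) ξ => ENNReal.ofReal (min (f ξ) n))
    (fun n => Measurable.of_discrete) fun n m hnm ξ =>
      ENNReal.ofReal_le_ofReal (min_le_min_left _ (Nat.cast_le.2 hnm))]
  refine iSup_le fun n => ?_
  refine (lintegral_evolved_le_of_bounded hg hφ hp Λ A ht
    (fun a b h => min_le_min_right _ (hf h)) (fun ξ => le_min (hf0 ξ) n.cast_nonneg)
    (fun ξ => min_le_right _ _) (fun ξ => by rw [hA])).trans ?_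
  exact lintegral_mono fun ξ => ENNReal.ofReal_le_ofReal (min_le_left _ _)

/-! ### Loss of mass through the boundary -/

/-- A summable bound, uniform for `|s| ≤ R`, on the terms of the series defining `S(s) f(η)`. -/
theorem abs_semigroup_term_le (hg : IsRate g) (hp : IsJumpLaw p) {f : FinConfig d → ℝ}
    (hf : LayerBdd f) (η : FinConfig d) : ∃ a : ℕ → ℝ, ∀ R : ℝ, 0 ≤ R →
      (Summable fun k : ℕ => R ^ k / (k.factorial : ℝ) * a k) ∧
      ∀ (k : ℕ) (s : ℝ), |s| ≤ R →
        |s ^ k / (k.factorial : ℝ) * ((generator g p)^[k] f) η|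
          ≤ R ^ k / (k.factorial : ℝ) * a k := by
  obtain ⟨C, hC⟩ := hf η.degree
  refine ⟨fun k => |((generator g p)^[k] f) η|, fun R hR => ⟨?_, fun k s hs => ?_⟩⟩
  · refine (summable_semigroup hg hp hf R η).congr fun k => ?_
    rw [Real.norm_eq_abs, abs_mul, abs_of_nonneg (by positivity)]
  · rw [abs_mul, abs_div, abs_pow, Nat.abs_cast]
    gcongr

theorem continuous_semigroup (hg : IsRate g) (hp : IsJumpLaw p) {f : FinConfig d → ℝ}
    (hf : LayerBdd f) (η : FinConfig d) : Continuous fun s => semigroup g p s f η := by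
  obtain ⟨a, ha⟩ := abs_semigroup_term_le hg hp hf η
  refine continuous_iff_continuousAt.2 fun s => ?_
  have h : ContinuousOn (fun s => semigroup g p s f η) (Set.Icc (-(|s| + 1)) (|s| + 1)) := by
    refine continuousOn_tsum (fun k => by fun_prop) (ha (|s| + 1) (by positivity)).1
      fun k r hr => (ha (|s| + 1) (by positivity)).2 k r (abs_le.2 hr)
  refine h.continuousAt (Icc_mem_nhds ?_ ?_)
  · linarith [neg_abs_le s]
  · linarith [le_abs_self s]

/-- The forward equation in integrated form. -/
theorem semigroup_eq_add_integral (hg : IsRate g) (hp : IsJumpLaw p) {f : FinConfig d → ℝ}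
    (hf : LayerBdd f) {t : ℝ} (ht : 0 ≤ t) (η : FinConfig d) :
    semigroup g p t f η = f η + ∫ s in (0 : ℝ)..t, semigroup g p s (generator g p f) η := by
  have hLf := hf.generator hg hp
  obtain ⟨a, ha⟩ := abs_semigroup_term_le hg hp hLf η
  obtain ⟨h1, h2⟩ := ha t ht
  have h3 := intervalIntegral.hasSum_integral_of_dominated_convergence (a := 0) (b := t)
    (μ := volume) (f := fun s => semigroup g p s (generator g p f) η)
    (F := fun k s => s ^ k / (k.factorial : ℝ) * ((generator g p)^[k] (generator g p f)) η)
    (fun k _ => t ^ k / (k.factorial : ℝ) * a k)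
    (fun k => (by fun_prop : Continuous _).aestronglyMeasurable)
    (fun k => Eventually.of_forall fun s hs => by
      rw [Set.uIoc_of_le ht] at hs
      exact h2 k s (by rw [abs_of_pos hs.1]; exact hs.2))
    (Eventually.of_forall fun s _ => h1) intervalIntegrable_const
    (Eventually.of_forall fun s _ => (summable_semigroup hg hp hLf s η).of_norm.hasSum)
  have h4 := (summable_semigroup hg hp hf t η).of_norm.tsum_eq_zero_add
  rw [semigroup, h4, ← h3.tsum_eq]
  congr 1
  · simp
  · refine tsum_congr fun k => ?_
    rw [intervalIntegral.integral_mul_const, intervalIntegral.integral_div, integral_pow,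
      Function.iterate_succ_apply, Nat.factorial_succ]
    push_cast
    field_simp
    simp only [ne_eq, Nat.add_eq_zero_iff, one_ne_zero, and_false, not_false_eq_true, zero_pow,
      sub_zero]
    ring

/-- The number of particles in `Λ`. -/
def mass (Λ : Finset (Site d)) (ξ : FinConfig d) : ℝ := ∑ x ∈ Λ, (ξ x : ℝ)

/-- The probability that a jump from `x` leaves `Λ`. -/
def exitProb (p : Site d → ℝ) (Λ : Finset (Site d)) (x : Site d) : ℝ :=
  ∑' y, p (y - x) * if y ∈ Λ then 0 else 1

/-- The rate at which particles jump out of `Λ`. -/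
def outflow (g : ℕ → ℝ) (p : Site d → ℝ) (Λ : Finset (Site d)) (ξ : FinConfig d) : ℝ :=
  ∑ x ∈ Λ, exitProb p Λ x * g (ξ x)

theorem exitProb_nonneg (hp : IsJumpLaw p) (Λ : Finset (Site d)) (x : Site d) :
    0 ≤ exitProb p Λ x :=
  tsum_nonneg fun y => mul_nonneg (hp.nonneg _) (by split_ifs <;> simp)

theorem summable_exitProb (hp : IsJumpLaw p) (Λ : Finset (Site d)) (x : Site d) :
    Summable fun y => p (y - x) * if y ∈ Λ then (0 : ℝ) else 1 :=
  Summable.of_nonneg_of_le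
    (fun y => mul_nonneg (hp.nonneg _) (by split_ifs <;> simp))
    (fun y => mul_le_of_le_one_right (hp.nonneg _) (by split_ifs <;> simp))
    (hp.hasSum_sub x).summable

theorem mass_nonneg (Λ : Finset (Site d)) (ξ : FinConfig d) : 0 ≤ mass Λ ξ :=
  Finset.sum_nonneg fun _ _ => Nat.cast_nonneg _

theorem layerBdd_mass (Λ : Finset (Site d)) : LayerBdd (mass Λ) := fun N => by
  refine ⟨∑ _x ∈ Λ, (N : ℝ), fun ξ hξ => ?_⟩
  rw [abs_of_nonneg (mass_nonneg Λ ξ)]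
  exact Finset.sum_le_sum fun x _ => by exact_mod_cast (Finsupp.le_degree x ξ).trans hξ

theorem outflow_nonneg (hg : IsRate g) (hp : IsJumpLaw p) (Λ : Finset (Site d))
    (ξ : FinConfig d) : 0 ≤ outflow g p Λ ξ :=
  Finset.sum_nonneg fun _ _ => mul_nonneg (exitProb_nonneg hp Λ _) (hg.nonneg _)

theorem layerBdd_outflow (hg : IsRate g) (hp : IsJumpLaw p) (Λ : Finset (Site d)) :
    LayerBdd (outflow g p Λ) := fun N => by
  refine ⟨∑ x ∈ Λ, exitProb p Λ x * g N, fun ξ hξ => ?_⟩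
  rw [abs_of_nonneg (outflow_nonneg hg hp Λ ξ)]
  exact Finset.sum_le_sum fun x _ => mul_le_mul_of_nonneg_left
    (hg.mono ((Finsupp.le_degree x ξ).trans hξ)) (exitProb_nonneg hp Λ x)

theorem monotone_outflow (hg : IsRate g) (hp : IsJumpLaw p) (Λ : Finset (Site d)) :
    Monotone (outflow g p Λ) := fun _ _ h =>
  Finset.sum_le_sum fun x _ => mul_le_mul_of_nonneg_left (hg.mono (h x)) (exitProb_nonneg hp Λ x)

theorem mass_move (Λ : Finset (Site d)) {η : FinConfig d} {x : Site d} (hx : x ∈ η.support)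
    (y : Site d) :
    mass Λ (move η x y) = mass Λ η - (if x ∈ Λ then 1 else 0) + if y ∈ Λ then 1 else 0 := by
  have h : ∀ z, ((move η x y z : ℕ) : ℝ)
      = η z - (if z = x then 1 else 0) + if z = y then 1 else 0 := fun z => by
    have h1 := Nat.one_le_iff_ne_zero.2 (Finsupp.mem_support_iff.1 hx)
    simp only [move, Finsupp.add_apply, Finsupp.tsub_apply, Finsupp.single_apply, eq_comm (a := z)]
    by_cases hz : x = z
    · subst hz
      simp [Nat.cast_sub h1]
    · simp [hz]
  simp only [mass, h, Finset.sum_add_distrib, Finset.sum_sub_distrib, Finset.sum_ite_eq']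

theorem neg_outflow_le_generator_mass (hg : IsRate g) (hp : IsJumpLaw p) (Λ : Finset (Site d))
    (η : FinConfig d) : -outflow g p Λ η ≤ generator g p (mass Λ) η := by
  have h1 : outflow g p Λ η = ∑ x ∈ η.support, g (η x) * if x ∈ Λ then exitProb p Λ x else 0 := by
    have e1 : outflow g p Λ η
        = ∑ x ∈ Λ ∪ η.support, g (η x) * if x ∈ Λ then exitProb p Λ x else 0 := by
      rw [outflow]
      refine (Finset.sum_congr rfl fun x hx => ?_).trans
        (Finset.sum_subset Finset.subset_union_left fun x _ hx => ?_)
      · rw [if_pos hx, mul_comm]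
      · rw [if_neg hx, mul_zero]
    rw [e1]
    refine (Finset.sum_subset Finset.subset_union_right fun x _ hx => ?_).symm
    rw [Finsupp.notMem_support_iff.1 hx, hg.zero, zero_mul]
  rw [h1, generator_eq hp (layerBdd_mass Λ), ← Finset.sum_neg_distrib]
  refine Finset.sum_le_sum fun x hx => ?_
  rw [← mul_neg]
  refine mul_le_mul_of_nonneg_left ?_ (hg.nonneg _)
  have h2 := (hp.hasSum_sub x).mul_right (mass Λ η)
  rw [one_mul] at h2
  have h3 := (summable_hop hp (layerBdd_mass Λ) hx).hasSum
  have h4 : ∀ y, p (y - x) * mass Λ (move η x y) = p (y - x) * mass Λ η +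
      p (y - x) * ((if y ∈ Λ then 1 else 0) - if x ∈ Λ then 1 else 0) := fun y => by
    rw [mass_move Λ hx]
    ring
  rw [hopAvg, neg_le_sub_iff_le_add]
  by_cases hxΛ : x ∈ Λ
  · rw [if_pos hxΛ]
    refine hasSum_le (fun y => ?_) h2 (h3.add (summable_exitProb hp Λ x).hasSum)
    rw [h4, if_pos hxΛ]
    split_ifs <;> simp
  · rw [if_neg hxΛ, add_zero]
    refine hasSum_le (fun y => ?_) h2 h3
    rw [h4, if_neg hxΛ]
    have := hp.nonneg (y - x)
    split_ifs <;> simp [this]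

theorem mass_le_add_integral (hg : IsRate g) (hp : IsJumpLaw p) (Λ : Finset (Site d)) {t : ℝ}
    (ht : 0 ≤ t) (η : FinConfig d) :
    mass Λ η ≤ semigroup g p t (mass Λ) η
      + ∫ s in (0 : ℝ)..t, semigroup g p s (outflow g p Λ) η := by
  have hb := layerBdd_outflow hg hp Λ
  have h1 := semigroup_eq_add_integral hg hp (layerBdd_mass Λ) ht η
  have h2 : -∫ s in (0 : ℝ)..t, semigroup g p s (outflow g p Λ) η
      ≤ ∫ s in (0 : ℝ)..t, semigroup g p s (generator g p (mass Λ)) η := by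
    rw [← intervalIntegral.integral_neg]
    refine intervalIntegral.integral_mono_on ht
      ((continuous_semigroup hg hp hb η).neg.intervalIntegrable _ _)
      ((continuous_semigroup hg hp ((layerBdd_mass Λ).generator hg hp) η).intervalIntegrable _ _)
      fun s hs => ?_
    have e := semigroup_le_semigroup hg hp (hb.const_mul (-1))
      ((layerBdd_mass Λ).generator hg hp) hs.1
      (fun ξ => (by linarith [neg_outflow_le_generator_mass hg hp Λ ξ] :
        -1 * outflow g p Λ ξ ≤ generator g p (mass Λ) ξ)) η
    have e' := semigroup_smul (g := g) (p := p) (-1) (outflow g p Λ) s η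
    have e'' : semigroup g p s (fun ξ => -1 * outflow g p Λ ξ) η
      = -1 * semigroup g p s (outflow g p Λ) η := e'
    linarith
  linarith

/-! ### Mean occupation numbers -/

theorem lintegral_fugacityMeasure_eval (hg : IsRate g) {φ : ℝ} (hφ : 0 < φ) (x : Site d)
    (F : ℕ → ENNReal) :
    ∫⁻ η, F (η x) ∂(fugacityMeasure d hg hφ : Measure (Config d))
      = ∑' k, F k * ENNReal.ofReal (siteWeight g φ k / partitionFn g φ) := by
  have h := measurePreserving_eval_infinitePi (fun _ : Site d => (sitePMF hg hφ).toMeasure) x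
  rw [fugacityMeasure, ProbabilityMeasure.coe_mk]
  rw [show (fun η : Config d => F (η x)) = fun η => F (Function.eval x η) from rfl,
    h.lintegral_comp .of_discrete, lintegral_countable']
  exact tsum_congr fun k => by
    rw [PMF.toMeasure_apply_singleton _ _ (measurableSet_singleton _), sitePMF_apply]

theorem lintegral_boxLaw_eval (hg : IsRate g) {φ : ℝ} (hφ : 0 < φ) {Λ : Finset (Site d)}
    {x : Site d} (hx : x ∈ Λ) (F : ℕ → ENNReal) :
    ∫⁻ ξ, F (ξ x) ∂(boxLaw hg hφ Λ)
      = ∑' k, F k * ENNReal.ofReal (siteWeight g φ k / partitionFn g φ) := by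
  rw [lintegral_boxLaw, ← lintegral_fugacityMeasure_eval hg hφ x]
  exact lintegral_congr fun η => by rw [restr_apply, if_pos hx]

/-- The mean jump rate of a site under `μ_φ` is `φ`. -/
theorem tsum_rate_mul_siteWeight (hg : IsRate g) {φ : ℝ} (hφ : 0 < φ) :
    ∑' k, ENNReal.ofReal (g k) * ENNReal.ofReal (siteWeight g φ k / partitionFn g φ)
      = ENNReal.ofReal φ := by
  have hz := partitionFn_pos hg hφ
  have h1 : HasSum (fun k => g (k + 1) * (siteWeight g φ (k + 1) / partitionFn g φ)) φ := by
    have e := (summable_weight hg hφ).hasSum.mul_left (φ / partitionFn g φ)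
    have e1 : φ / partitionFn g φ * ∑' k, weight g k * φ ^ k = φ := div_mul_cancel₀ φ hz.ne'
    rw [e1] at e
    refine e.congr_fun fun k => ?_
    have := siteWeight_succ_mul hg φ k
    rw [show weight g k * φ ^ k = siteWeight g φ k from rfl]
    field_simp
    linear_combination this
  have h0 : ∀ k, 0 ≤ g k * (siteWeight g φ k / partitionFn g φ) := fun k =>
    mul_nonneg (hg.nonneg k) (div_pos (siteWeight_pos hg hφ k) hz).le
  have h2 : HasSum (fun k => g k * (siteWeight g φ k / partitionFn g φ)) φ := by
    refine (hasSum_nat_add_iff' 1).1 ?_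
    simpa [hg.zero] using h1
  have h3 := ENNReal.ofReal_tsum_of_nonneg h0 h2.summable
  rw [h2.tsum_eq] at h3
  rw [h3]
  exact tsum_congr fun k => (ENNReal.ofReal_mul (hg.nonneg k)).symm

/-- The mean number `ρ` of particles at a site under `μ_φ`. -/
def density (g : ℕ → ℝ) (φ : ℝ) : ENNReal :=
  ∑' k : ℕ, ENNReal.ofReal (k : ℝ) * ENNReal.ofReal (siteWeight g φ k / partitionFn g φ)

theorem density_ne_top (hg : IsRate g) {φ : ℝ} (hφ : 0 < φ) : density g φ ≠ ⊤ := by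
  have hz := partitionFn_pos hg hφ
  -- The bound `k ≤ 2 ^ k` reduces the first moment to the weights at fugacity `2 φ`.
  have h2 : Summable fun k => siteWeight g (2 * φ) k / partitionFn g φ :=
    (summable_weight hg (by positivity : 0 < 2 * φ)).div_const _
  refine ne_top_of_le_ne_top h2.tsum_ofReal_ne_top (ENNReal.tsum_le_tsum fun k => ?_)
  rw [← ENNReal.ofReal_mul (Nat.cast_nonneg k)]
  refine ENNReal.ofReal_le_ofReal ?_
  have hk : (k : ℝ) ≤ 2 ^ k := by exact_mod_cast Nat.lt_two_pow_self.le
  calc (k : ℝ) * (siteWeight g φ k / partitionFn g φ)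
      ≤ 2 ^ k * (siteWeight g φ k / partitionFn g φ) :=
        mul_le_mul_of_nonneg_right hk (div_pos (siteWeight_pos hg hφ k) hz).le
    _ = siteWeight g (2 * φ) k / partitionFn g φ := by
        rw [siteWeight, siteWeight, mul_pow]
        ring

/-- The mean number of particles at `x` at time `t`, for the process started from the restriction
of `μ_φ` to `Λ`. -/
def siteMean (hg : IsRate g) {φ : ℝ} (hφ : 0 < φ) (p : Site d → ℝ) (t : ℝ) (Λ : Finset (Site d))
    (x : Site d) : ENNReal :=
  ∫⁻ ξ, ENNReal.ofReal (ξ x : ℝ) ∂(evolved hg hφ p Λ t)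

theorem lintegral_mass (ν : Measure (FinConfig d)) (Λ : Finset (Site d)) :
    ∫⁻ ξ, ENNReal.ofReal (mass Λ ξ) ∂ν = ∑ x ∈ Λ, ∫⁻ ξ, ENNReal.ofReal (ξ x : ℝ) ∂ν := by
  rw [← lintegral_finsetSum _ fun x _ => Measurable.of_discrete]
  exact lintegral_congr fun ξ => ENNReal.ofReal_sum_of_nonneg fun x _ => Nat.cast_nonneg _

theorem lintegral_mass_boxLaw (hg : IsRate g) {φ : ℝ} (hφ : 0 < φ) (Λ : Finset (Site d)) :
    ∫⁻ ξ, ENNReal.ofReal (mass Λ ξ) ∂(boxLaw hg hφ Λ) = Λ.card * density g φ := by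
  rw [lintegral_mass, Finset.sum_congr rfl fun x hx =>
    lintegral_boxLaw_eval hg hφ hx fun k => ENNReal.ofReal (k : ℝ), Finset.sum_const, nsmul_eq_mul]
  rfl

theorem lintegral_outflow_boxLaw (hg : IsRate g) {φ : ℝ} (hφ : 0 < φ) (hp : IsJumpLaw p)
    (Λ : Finset (Site d)) :
    ∫⁻ ξ, ENNReal.ofReal (outflow g p Λ ξ) ∂(boxLaw hg hφ Λ)
      = ENNReal.ofReal (∑ x ∈ Λ, exitProb p Λ x * φ) := by
  have h1 : ∀ ξ, ENNReal.ofReal (outflow g p Λ ξ)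
      = ∑ x ∈ Λ, ENNReal.ofReal (exitProb p Λ x) * ENNReal.ofReal (g (ξ x)) := fun ξ => by
    rw [outflow, ENNReal.ofReal_sum_of_nonneg fun x _ =>
      mul_nonneg (exitProb_nonneg hp Λ x) (hg.nonneg _)]
    exact Finset.sum_congr rfl fun x _ => ENNReal.ofReal_mul (exitProb_nonneg hp Λ x)
  rw [lintegral_congr h1, lintegral_finsetSum _ fun x _ => Measurable.of_discrete,
    ENNReal.ofReal_sum_of_nonneg fun x _ => mul_nonneg (exitProb_nonneg hp Λ x) hφ.le]
  refine Finset.sum_congr rfl fun x hx => ?_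
  rw [lintegral_const_mul _ Measurable.of_discrete,
    lintegral_boxLaw_eval hg hφ hx fun k => ENNReal.ofReal (g k),
    tsum_rate_mul_siteWeight hg hφ, ENNReal.ofReal_mul (exitProb_nonneg hp Λ x)]

theorem mass_restr (Λ : Finset (Site d)) (ξ : FinConfig d) : mass Λ (restr Λ ξ) = mass Λ ξ :=
  Finset.sum_congr rfl fun x hx => by rw [restr_apply, if_pos hx]

theorem outflow_restr (Λ : Finset (Site d)) (ξ : FinConfig d) :
    outflow g p Λ (restr Λ ξ) = outflow g p Λ ξ :=
  Finset.sum_congr rfl fun x hx => by rw [restr_apply, if_pos hx]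

/-- Up to time `t`, the expected mass lost by `Λ` is at most `t φ ∑_{x ∈ Λ} p(x, Λᶜ)`: by
domination, the mean jump rates never exceed their value `φ` under `μ_φ`. -/
theorem card_mul_density_le (hg : IsRate g) {φ : ℝ} (hφ : 0 < φ) (hp : IsJumpLaw p)
    (Λ : Finset (Site d)) {t : ℝ} (ht : 0 ≤ t) :
    Λ.card * density g φ ≤ ∑ x ∈ Λ, siteMean hg hφ p t Λ x
      + ENNReal.ofReal (t * (φ * ∑ x ∈ Λ, exitProb p Λ x)) := by
  have hb := layerBdd_outflow hg hp Λ
  have hS0 : ∀ s, 0 ≤ s → ∀ ξ : FinConfig d, 0 ≤ semigroup g p s (outflow g p Λ) ξ :=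
    fun s hs ξ => semigroup_nonneg hg hp hb hs (fun ζ _ => outflow_nonneg hg hp Λ ζ)
      (le_refl ξ.degree)
  have h1 : ∀ ξ : FinConfig d, ENNReal.ofReal (mass Λ ξ)
      ≤ ENNReal.ofReal (semigroup g p t (mass Λ) ξ)
        + ∫⁻ s in Set.Ioc 0 t, ENNReal.ofReal (semigroup g p s (outflow g p Λ) ξ) := by
    intro ξ
    have e : ENNReal.ofReal (∫ s in (0 : ℝ)..t, semigroup g p s (outflow g p Λ) ξ)
        = ∫⁻ s in Set.Ioc 0 t, ENNReal.ofReal (semigroup g p s (outflow g p Λ) ξ) := by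
      rw [intervalIntegral.integral_of_le ht]
      refine ofReal_integral_eq_lintegral_ofReal
        (continuous_semigroup hg hp hb ξ).integrableOn_Ioc ?_
      filter_upwards [ae_restrict_mem measurableSet_Ioc] with s hs
      exact hS0 s hs.1.le ξ
    rw [← e]
    exact (ENNReal.ofReal_le_ofReal (mass_le_add_integral hg hp Λ ht ξ)).trans
      ENNReal.ofReal_add_le
  rw [← lintegral_mass_boxLaw hg hφ Λ]
  refine (lintegral_mono h1).trans ?_
  rw [lintegral_add_left Measurable.of_discrete]
  refine add_le_add ?_ ?_
  · rw [← lintegral_evolved hg hφ hp Λ ht (layerBdd_mass Λ) (mass_nonneg Λ), lintegral_mass]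
    rfl
  · rw [lintegral_lintegral_swap]
    · calc ∫⁻ s in Set.Ioc 0 t, ∫⁻ ξ, ENNReal.ofReal (semigroup g p s (outflow g p Λ) ξ)
            ∂(boxLaw hg hφ Λ)
          ≤ ∫⁻ _ in Set.Ioc 0 t, ENNReal.ofReal (∑ x ∈ Λ, exitProb p Λ x * φ) := by
            refine setLIntegral_mono measurable_const fun s hs => ?_
            rw [← lintegral_evolved hg hφ hp Λ hs.1.le hb (outflow_nonneg hg hp Λ),
              ← lintegral_outflow_boxLaw hg hφ hp Λ]
            exact lintegral_evolved_le hg hφ hp Λ Λ hs.1.le (monotone_outflow hg hp Λ)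
              (outflow_nonneg hg hp Λ) (outflow_restr Λ)
        _ = _ := by
            rw [setLIntegral_const, Real.volume_Ioc, sub_zero, ← Finset.sum_mul, mul_comm,
              ENNReal.ofReal_mul ht, mul_comm φ]
    · refine Measurable.aemeasurable (measurable_from_prod_countable_right fun ξ => ?_)
      exact (continuous_semigroup hg hp hb ξ).measurable.ennreal_ofReal

/-! ### Translations -/

/-- The configuration `η(· + z)`. -/
def translate (z : Site d) (η : FinConfig d) : FinConfig d :=
  Finsupp.equivMapDomain (Equiv.subRight z) η

theorem translate_apply (z : Site d) (η : FinConfig d) (x : Site d) :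
    translate z η x = η (x + z) := rfl

theorem translate_move (z : Site d) (η : FinConfig d) (x y : Site d) :
    translate z (move η x y) = move (translate z η) (x - z) (y - z) := by
  ext u
  simp only [translate_apply, move, Finsupp.add_apply, Finsupp.tsub_apply, Finsupp.single_apply,
    sub_eq_iff_eq_add]

theorem generator_comp_translate (z : Site d) (f : FinConfig d → ℝ) :
    generator g p (f ∘ translate z) = generator g p f ∘ translate z := by
  funext η
  have hs : (translate z η).support = η.support.map (Equiv.subRight z).toEmbedding := rfl
  rw [Function.comp_apply, generator, generator, hs, Finset.sum_map]
  refine Finset.sum_congr rfl fun x _ => ?_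
  symm
  rw [← (Equiv.subRight z).tsum_eq]
  refine tsum_congr fun y => ?_
  simp only [Equiv.coe_toEmbedding, Equiv.subRight_apply, translate_apply, sub_add_cancel,
    Function.comp_apply, translate_move, sub_sub_sub_cancel_right]

theorem semigroup_comp_translate (z : Site d) (f : FinConfig d → ℝ) (t : ℝ) (η : FinConfig d) :
    semigroup g p t (f ∘ translate z) η = semigroup g p t f (translate z η) := by
  have h : ∀ k : ℕ, (generator g p)^[k] (f ∘ translate z)
      = (generator g p)^[k] f ∘ translate z := by
    intro k
    induction k with
    | zero => rfl
    | succ k ih =>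
      rw [Function.iterate_succ_apply', ih, generator_comp_translate,
        Function.iterate_succ_apply']
  simp only [semigroup, h, Function.comp_apply]

/-- The number of particles at `x`, as a function on configurations. -/
def occ (x : Site d) (ξ : FinConfig d) : ℝ := ξ x

theorem occ_nonneg (x : Site d) (ξ : FinConfig d) : 0 ≤ occ x ξ := Nat.cast_nonneg _

theorem layerBdd_occ (x : Site d) : LayerBdd (occ x) := fun N => by
  refine ⟨N, fun ξ hξ => ?_⟩
  rw [abs_of_nonneg (occ_nonneg x ξ)]
  exact Nat.cast_le.2 ((Finsupp.le_degree x ξ).trans hξ)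

theorem monotone_occ (x : Site d) : Monotone (occ x) := fun _ _ h => Nat.cast_le.2 (h x)

theorem siteMean_eq (hg : IsRate g) {φ : ℝ} (hφ : 0 < φ) (hp : IsJumpLaw p) {t : ℝ} (ht : 0 ≤ t)
    (Λ : Finset (Site d)) (x : Site d) :
    siteMean hg hφ p t Λ x = ∫⁻ η, ENNReal.ofReal (semigroup g p t (occ x) (restr Λ η))
      ∂(fugacityMeasure d hg hφ : Measure (Config d)) := by
  rw [← lintegral_boxLaw hg hφ Λ fun ξ => ENNReal.ofReal (semigroup g p t (occ x) ξ),
    ← lintegral_evolved hg hφ hp Λ ht (layerBdd_occ x) (occ_nonneg x)]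
  rfl

/-- By attractivity, more particles at time `0` give more particles at time `t`. -/
theorem siteMean_mono (hg : IsRate g) {φ : ℝ} (hφ : 0 < φ) (hp : IsJumpLaw p) {t : ℝ}
    (ht : 0 ≤ t) (x : Site d) : Monotone fun Λ => siteMean hg hφ p t Λ x := by
  intro Λ Λ' h
  simp only [siteMean_eq hg hφ hp ht]
  exact lintegral_mono fun η => ENNReal.ofReal_le_ofReal
    (semigroup_monotone hg hp (layerBdd_occ x) (monotone_occ x) ht (restr_mono h η))

theorem map_translate_fugacityMeasure (hg : IsRate g) {φ : ℝ} (hφ : 0 < φ) (z : Site d) :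
    (fugacityMeasure d hg hφ : Measure (Config d)).map (fun η x => η (x + z))
      = fugacityMeasure d hg hφ :=
  Measure.map_infinitePi_infinitePi_of_inj (P := fun _ : Site d => (sitePMF hg hφ).toMeasure)
    (add_left_injective z)

theorem siteMean_map_addRight (hg : IsRate g) {φ : ℝ} (hφ : 0 < φ) (hp : IsJumpLaw p) {t : ℝ}
    (ht : 0 ≤ t) (Λ : Finset (Site d)) (z : Site d) :
    siteMean hg hφ p t (Λ.map (Equiv.addRight z).toEmbedding) z = siteMean hg hφ p t Λ 0 := by
  rw [siteMean_eq hg hφ hp ht, siteMean_eq hg hφ hp ht]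
  conv_rhs => rw [← map_translate_fugacityMeasure hg hφ z]
  have hm : Measurable fun η : Config d => ENNReal.ofReal (semigroup g p t (occ 0) (restr Λ η)) :=
    (Measurable.of_discrete (f := fun ξ => ENNReal.ofReal (semigroup g p t (occ 0) ξ))).comp
      (measurable_restr Λ)
  rw [lintegral_map hm (measurable_pi_lambda _ fun x => measurable_pi_apply _)]
  refine lintegral_congr fun η => ?_
  have h1 : occ z = occ 0 ∘ translate z := by
    funext ξ
    simp [occ, translate_apply]
  rw [h1, semigroup_comp_translate]
  congr 2
  ext x
  rw [translate_apply, restr_apply, restr_apply]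
  simp

theorem siteMean_le_density (hg : IsRate g) {φ : ℝ} (hφ : 0 < φ) (hp : IsJumpLaw p) {t : ℝ}
    (ht : 0 ≤ t) (Λ : Finset (Site d)) (x : Site d) : siteMean hg hφ p t Λ x ≤ density g φ := by
  refine (lintegral_evolved_le hg hφ hp Λ {x} ht (monotone_occ x) (occ_nonneg x)
    fun ξ => ?_).trans_eq
    (lintegral_boxLaw_eval hg hφ (Finset.mem_singleton_self x) fun k => ENNReal.ofReal (k : ℝ))
  rw [occ, occ, restr_apply, if_pos (Finset.mem_singleton_self x)]

/-! ### Boxes -/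

theorem mem_box {n : ℕ} {x : Site d} : x ∈ box d n ↔ ∀ i, |x i| ≤ n := by
  simp only [box, Finset.mem_Icc, Pi.le_def, abs_le]
  exact forall_and.symm

theorem box_mono : Monotone (box d) := fun n m h x hx => by
  rw [mem_box] at hx ⊢
  exact fun i => (hx i).trans (by exact_mod_cast h)

theorem exists_subset_box (A : Finset (Site d)) : ∃ n, A ⊆ box d n := by
  refine ⟨A.sup fun x => Finset.univ.sup fun i => (x i).natAbs, fun x hx => ?_⟩
  rw [mem_box]
  intro i
  have h1 : (x i).natAbs ≤ Finset.univ.sup fun i => (x i).natAbs :=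
    Finset.le_sup (f := fun i => (x i).natAbs) (Finset.mem_univ i)
  have h2 := h1.trans (Finset.le_sup (f := fun x : Site d => Finset.univ.sup fun i =>
    (x i).natAbs) hx)
  rw [Int.abs_eq_natAbs]
  exact_mod_cast h2

theorem card_box (n : ℕ) : (box d n).card = (2 * n + 1) ^ d := by
  rw [box, Pi.card_Icc]
  simp only [Int.card_Icc, Finset.prod_const, Finset.card_univ, Fintype.card_fin]
  congr 1
  omega

/-- The proportion of sites of the box which are moved out of it by `z`. -/
def outFraction (n : ℕ) (z : Site d) : ℝ :=
  (((box d n).filter fun x => x + z ∉ box d n).card : ℝ) / (box d n).card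

theorem outFraction_nonneg (n : ℕ) (z : Site d) : 0 ≤ outFraction n z := by
  unfold outFraction
  positivity

theorem outFraction_le_one (n : ℕ) (z : Site d) : outFraction n z ≤ 1 :=
  div_le_one_of_le₀ (Nat.cast_le.2 (Finset.card_filter_le _ _)) (Nat.cast_nonneg _)

theorem tendsto_outFraction (z : Site d) :
    Tendsto (fun n => outFraction n z) atTop (𝓝 0) := by
  obtain ⟨m, hm⟩ := exists_subset_box {z}
  rw [Finset.singleton_subset_iff, mem_box] at hm
  -- A site of the box of radius `n` cannot be moved out of the box of radius `n + m`.
  have h1 : ∀ n, outFraction (n + m) z ≤ 1 - ((2 * n + 1 : ℝ) / (2 * (n + m) + 1)) ^ d := by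
    intro n
    have hsub : box d n ⊆ (box d (n + m)).filter fun x => x + z ∈ box d (n + m) := fun x hx => by
      rw [Finset.mem_filter]
      refine ⟨box_mono (Nat.le_add_right n m) hx, ?_⟩
      rw [mem_box] at hx ⊢
      intro i
      push_cast
      exact (abs_add_le _ _).trans (add_le_add (hx i) (hm i))
    have hcard := Finset.card_filter_add_card_filter_not (s := box d (n + m))
      fun x => x + z ∈ box d (n + m)
    have hle := Finset.card_le_card hsub
    have hpos : (0 : ℝ) < (box d (n + m)).card := by
      rw [card_box]
      positivity
    have e : ((2 * n + 1 : ℝ) / (2 * (n + m) + 1)) ^ d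
        = ((box d n).card : ℝ) / (box d (n + m)).card := by
      rw [card_box, card_box, div_pow]
      push_cast
      rfl
    rw [e, outFraction, le_sub_iff_add_le, ← add_div, div_le_one hpos]
    exact_mod_cast (by omega :
      ((box d (n + m)).filter fun x => x + z ∉ box d (n + m)).card + (box d n).card
        ≤ (box d (n + m)).card)
  have h2 : Tendsto (fun n : ℕ => 1 - ((2 * n + 1 : ℝ) / (2 * (n + m) + 1)) ^ d) atTop
      (𝓝 0) := by
    have e1 : Tendsto (fun n : ℕ => (2 * m : ℝ) / (2 * (n + m) + 1)) atTop (𝓝 0) := by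
      refine tendsto_const_nhds.div_atTop (tendsto_atTop_mono (fun n => ?_)
        tendsto_natCast_atTop_atTop)
      have : (0 : ℝ) ≤ n := n.cast_nonneg
      have : (0 : ℝ) ≤ m := m.cast_nonneg
      linarith
    have e2 : Tendsto (fun n : ℕ => (2 * n + 1 : ℝ) / (2 * (n + m) + 1)) atTop (𝓝 1) := by
      have e3 := e1.const_sub 1
      rw [sub_zero] at e3
      refine e3.congr fun n => ?_
      have : (2 * (n + m) + 1 : ℝ) ≠ 0 := by positivity
      field_simp
      ring
    simpa using (e2.pow d).const_sub 1
  exact (tendsto_add_atTop_iff_nat m).1 (squeeze_zero (fun n => outFraction_nonneg _ _) h1 h2)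

theorem sum_exitProb_div_card (hp : IsJumpLaw p) (n : ℕ) :
    (∑ x ∈ box d n, exitProb p (box d n) x) / (box d n).card = ∑' z, p z * outFraction n z := by
  have h1 : ∀ x, exitProb p (box d n) x
      = ∑' z, p z * if x + z ∈ box d n then 0 else 1 := fun x => by
    rw [exitProb, ← (Equiv.addLeft x).tsum_eq]
    refine tsum_congr fun z => ?_
    change p (x + z - x) * (if x + z ∈ box d n then 0 else 1) = _
    rw [add_sub_cancel_left]
  have hs : ∀ x ∈ box d n, Summable fun z => p z * if x + z ∈ box d n then (0 : ℝ) else 1 :=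
    fun x _ => Summable.of_nonneg_of_le
      (fun z => mul_nonneg (hp.nonneg _) (by split_ifs <;> simp))
      (fun z => mul_le_of_le_one_right (hp.nonneg _) (by split_ifs <;> simp)) hp.hasSum.summable
  rw [Finset.sum_congr rfl fun x _ => h1 x, ← Summable.tsum_finsetSum hs, ← tsum_div_const]
  refine tsum_congr fun z => ?_
  rw [← Finset.mul_sum, outFraction, mul_div_assoc, Finset.card_filter]
  push_cast
  simp only [ite_not]

/-- The mean probability for a jump from a site of the box to leave the box vanishes in the limit
of large boxes. -/
theorem tendsto_sum_exitProb_div_card (hp : IsJumpLaw p) :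
    Tendsto (fun n => (∑ x ∈ box d n, exitProb p (box d n) x) / (box d n).card) atTop (𝓝 0) := by
  simp only [sum_exitProb_div_card hp]
  have h := tendsto_tsum_of_dominated_convergence (𝓕 := atTop)
    (f := fun n z => p z * outFraction n z) (g := fun _ : Site d => (0 : ℝ)) hp.hasSum.summable
    (fun z => by simpa using (tendsto_outFraction z).const_mul (p z))
    (Eventually.of_forall fun n z => by
      rw [Real.norm_eq_abs, abs_of_nonneg (mul_nonneg (hp.nonneg z) (outFraction_nonneg n z))]
      exact mul_le_of_le_one_right (hp.nonneg z) (outFraction_le_one n z))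
  simpa using h

/-- No mass is lost in the limit: by translation invariance, all means `siteMean Λ x` have the same
supremum over `Λ`, and the box of radius `n` as a whole loses mass `o(n ^ d)` only. -/
theorem density_le_iSup_siteMean (hg : IsRate g) {φ : ℝ} (hφ : 0 < φ) (hp : IsJumpLaw p) {t : ℝ}
    (ht : 0 ≤ t) : density g φ ≤ ⨆ Λ : Finset (Site d), siteMean hg hφ p t Λ 0 := by
  set a := ⨆ Λ : Finset (Site d), siteMean hg hφ p t Λ 0
  have hle : ∀ Λ x, siteMean hg hφ p t Λ x ≤ a := fun Λ x => by
    have h := siteMean_map_addRight hg hφ hp ht (Λ.map (Equiv.subRight x).toEmbedding) x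
    rw [Finset.map_map] at h
    have e : (Equiv.subRight x).toEmbedding.trans (Equiv.addRight x).toEmbedding
        = Function.Embedding.refl (Site d) := by
      ext y
      simp
    rw [e, Finset.map_refl] at h
    rw [h]
    exact le_iSup (fun Λ => siteMean hg hφ p t Λ 0) _
  have h1 : ∀ n, density g φ ≤ a + ENNReal.ofReal
      (t * φ * ((∑ x ∈ box d n, exitProb p (box d n) x) / (box d n).card)) := by
    intro n
    have hc : (0 : ℝ) < (box d n).card := by
      rw [card_box]
      positivity
    have hc0 : ((box d n).card : ENNReal) ≠ 0 := by
      rw [Nat.cast_ne_zero]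
      exact_mod_cast hc.ne'
    have h2 := card_mul_density_le hg hφ hp (box d n) ht
    have h3 : ∑ x ∈ box d n, siteMean hg hφ p t (box d n) x ≤ (box d n).card * a := by
      refine (Finset.sum_le_sum fun x _ => hle (box d n) x).trans_eq ?_
      rw [Finset.sum_const, nsmul_eq_mul]
    have h4 : t * (φ * ∑ x ∈ box d n, exitProb p (box d n) x) = (box d n).card *
        (t * φ * ((∑ x ∈ box d n, exitProb p (box d n) x) / (box d n).card)) := by
      field_simp
    rw [h4, ENNReal.ofReal_mul hc.le, ENNReal.ofReal_natCast] at h2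
    refine (ENNReal.mul_le_mul_iff_right hc0 (ENNReal.natCast_ne_top _)).1
      (h2.trans ((add_le_add_left h3 _).trans_eq (mul_add _ _ _).symm))
  refine ge_of_tendsto' (x := atTop) ?_ h1
  have h5 := ((tendsto_sum_exitProb_div_card (d := d) hp).const_mul (t * φ))
  rw [mul_zero] at h5
  have h6 := (ENNReal.tendsto_ofReal h5).const_add a
  rwa [ENNReal.ofReal_zero, add_zero] at h6

theorem tendsto_siteMean_box (hg : IsRate g) {φ : ℝ} (hφ : 0 < φ) (hp : IsJumpLaw p) {t : ℝ}
    (ht : 0 ≤ t) (x : Site d) :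
    Tendsto (fun n => siteMean hg hφ p t (box d n) x) atTop (𝓝 (density g φ)) := by
  have h1 : Tendsto (fun n => siteMean hg hφ p t (box d n) x) atTop _ :=
    tendsto_atTop_iSup ((siteMean_mono hg hφ hp ht x).comp box_mono)
  convert h1 using 2
  refine le_antisymm ((density_le_iSup_siteMean hg hφ hp ht).trans (iSup_le fun Λ => ?_))
    (iSup_le fun n => siteMean_le_density hg hφ hp ht _ _)
  obtain ⟨n, hn⟩ := exists_subset_box (Λ.map (Equiv.addRight x).toEmbedding)
  rw [← siteMean_map_addRight hg hφ hp ht Λ x]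
  exact le_iSup_of_le n (siteMean_mono hg hφ hp ht x hn)

/-! ### Weak convergence -/

/-- The configurations all of whose modifications outside `A` belong to `G`. -/
def innerCylinder (A : Finset (Site d)) (G : Set (Config d)) : Set (Config d) :=
  {η | ∀ ζ : Config d, (∀ x ∈ A, ζ x = η x) → ζ ∈ G}

theorem innerCylinder_subset (A : Finset (Site d)) (G : Set (Config d)) :
    innerCylinder A G ⊆ G := fun η h => h η fun _ _ => rfl

theorem mem_innerCylinder_congr {A : Finset (Site d)} {G : Set (Config d)} {η ξ : Config d}
    (h : ∀ x ∈ A, η x = ξ x) : η ∈ innerCylinder A G ↔ ξ ∈ innerCylinder A G :=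
  ⟨fun h1 ζ hζ => h1 ζ fun x hx => (hζ x hx).trans (h x hx).symm,
    fun h1 ζ hζ => h1 ζ fun x hx => (hζ x hx).trans (h x hx)⟩

theorem restr_mem_innerCylinder {A : Finset (Site d)} {G : Set (Config d)} {η : Config d} :
    (restr A η : Config d) ∈ innerCylinder A G ↔ η ∈ innerCylinder A G :=
  mem_innerCylinder_congr fun x hx => by rw [restr_apply, if_pos hx]

theorem measurableSet_innerCylinder (A : Finset (Site d)) (G : Set (Config d)) :
    MeasurableSet (innerCylinder A G) := by
  have h : innerCylinder A G
      = restr A ⁻¹' {ξ : FinConfig d | (ξ : Config d) ∈ innerCylinder A G} := by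
    ext η
    exact restr_mem_innerCylinder.symm
  rw [h]
  exact measurable_restr A (MeasurableSet.of_discrete)

theorem iUnion_innerCylinder_box {G : Set (Config d)} (hG : IsOpen G) :
    ⋃ n, innerCylinder (box d n) G = G := by
  refine Set.Subset.antisymm (Set.iUnion_subset fun n => innerCylinder_subset _ _) fun η hη => ?_
  obtain ⟨I, u, hu, hI⟩ := isOpen_pi_iff.1 hG η hη
  obtain ⟨n, hn⟩ := exists_subset_box I
  refine Set.mem_iUnion.2 ⟨n, fun ζ hζ => hI fun x hx => ?_⟩
  rw [hζ x (hn hx)]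
  exact (hu x hx).2

theorem monotone_innerCylinder_box (G : Set (Config d)) :
    Monotone fun n => innerCylinder (box d n) G :=
  fun _ _ h _ hη ζ hζ => hη ζ fun x hx => hζ x (box_mono h hx)

/-- The number of particles in `A` dominates the oscillation of any event in `A`: if the
configuration in `A` increases, then this number grows by at least one. -/
theorem monotone_mass_add_indicator (A : Finset (Site d)) (G : Set (Config d)) :
    Monotone fun ξ : FinConfig d =>
      mass A ξ + Set.indicator (innerCylinder A G)ᶜ (fun _ => (1 : ℝ)) (ξ : Config d) := by
  intro a b hab
  by_cases h : ∀ x ∈ A, a x = b x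
  · have h1 : mass A a = mass A b := Finset.sum_congr rfl fun x hx => by rw [h x hx]
    have h2 : ((a : Config d) ∈ (innerCylinder A G)ᶜ) ↔ (b : Config d) ∈ (innerCylinder A G)ᶜ :=
      not_congr (mem_innerCylinder_congr h)
    have h3 : Set.indicator (innerCylinder A G)ᶜ (fun _ => (1 : ℝ)) (a : Config d)
        = Set.indicator (innerCylinder A G)ᶜ (fun _ => (1 : ℝ)) (b : Config d) := by
      classical simp only [Set.indicator_apply, h2]
    exact (congrArg₂ (· + ·) h1 h3).le
  · push Not at h
    obtain ⟨x, hx, hne⟩ := h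
    have h1 : mass A a + 1 ≤ mass A b := by
      have : ∑ y ∈ A, a y < ∑ y ∈ A, b y :=
        Finset.sum_lt_sum (fun y _ => hab y) ⟨x, hx, lt_of_le_of_ne (hab x) hne⟩
      rw [mass, mass]
      exact_mod_cast this
    have h2 : Set.indicator (innerCylinder A G)ᶜ (fun _ => (1 : ℝ)) (a : Config d) ≤ 1 :=
      Set.indicator_le_self' (fun _ _ => zero_le_one) _
    have h3 : 0 ≤ Set.indicator (innerCylinder A G)ᶜ (fun _ => (1 : ℝ)) (b : Config d) :=
      Set.indicator_nonneg (fun _ _ => zero_le_one) _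
    change mass A a + _ ≤ mass A b + _
    linarith

theorem lintegral_mass_add_indicator (ν : Measure (FinConfig d)) (A : Finset (Site d))
    (B : Set (Config d)) :
    ∫⁻ ξ, ENNReal.ofReal (mass A ξ + Set.indicator B (fun _ => (1 : ℝ)) (ξ : Config d)) ∂ν
      = ∑ x ∈ A, ∫⁻ ξ, ENNReal.ofReal (ξ x : ℝ) ∂ν + ν {ξ | (ξ : Config d) ∈ B} := by
  have h : ∀ ξ : FinConfig d,
      ENNReal.ofReal (mass A ξ + Set.indicator B (fun _ => (1 : ℝ)) (ξ : Config d))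
        = ENNReal.ofReal (mass A ξ)
          + Set.indicator {ξ : FinConfig d | (ξ : Config d) ∈ B} 1 ξ := fun ξ => by
    rw [ENNReal.ofReal_add (mass_nonneg A ξ) (Set.indicator_nonneg (fun _ _ => zero_le_one) _)]
    congr 1
    by_cases hξ : (ξ : Config d) ∈ B <;> simp [hξ]
  rw [lintegral_congr h, lintegral_add_left Measurable.of_discrete, lintegral_mass,
    lintegral_indicator_one MeasurableSet.of_discrete]

/-- A lower bound for the evolved probability of an event in `A`, in terms of the loss of mass
in `A`. -/
theorem sum_siteMean_add_measure_le (hg : IsRate g) {φ : ℝ} (hφ : 0 < φ) (hp : IsJumpLaw p)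
    {t : ℝ} (ht : 0 ≤ t) (Λ A : Finset (Site d)) (G : Set (Config d)) :
    ∑ x ∈ A, siteMean hg hφ p t Λ x
        + (fugacityMeasure d hg hφ : Measure (Config d)) (innerCylinder A G)
      ≤ A.card * density g φ
        + evolved hg hφ p Λ t {ξ | (ξ : Config d) ∈ innerCylinder A G} := by
  set C := innerCylinder A G
  set μ := (fugacityMeasure d hg hφ : Measure (Config d))
  have hC : MeasurableSet C := measurableSet_innerCylinder A G
  have h1 := lintegral_evolved_le hg hφ hp Λ A ht (monotone_mass_add_indicator A G)
    (fun ξ => add_nonneg (mass_nonneg A ξ) (Set.indicator_nonneg (fun _ _ => zero_le_one) _))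
    fun ξ => by
      rw [mass_restr]
      congr 1
      classical simp only [Set.indicator_apply, Set.mem_compl_iff, restr_mem_innerCylinder]
  rw [lintegral_mass_add_indicator, lintegral_mass_add_indicator, 
    ← lintegral_mass (boxLaw hg hφ A), lintegral_mass_boxLaw] at h1
  have h2 : boxLaw hg hφ A {ξ | (ξ : Config d) ∈ Cᶜ} = μ Cᶜ := by
    rw [boxLaw, Measure.map_apply (measurable_restr A) MeasurableSet.of_discrete]
    congr 1
    ext η
    exact not_congr restr_mem_innerCylinder
  rw [h2] at h1
  have hprob := isProbabilityMeasure_evolved hg hφ hp Λ ht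
  have h3 : evolved hg hφ p Λ t {ξ | (ξ : Config d) ∈ C}
      + evolved hg hφ p Λ t {ξ | (ξ : Config d) ∈ Cᶜ} = 1 :=
    (measure_add_measure_compl MeasurableSet.of_discrete).trans measure_univ
  have h4 : μ C + μ Cᶜ = 1 := (measure_add_measure_compl hC).trans measure_univ
  -- Pass from `Cᶜ` to `C`, adding one on both sides to avoid truncated subtraction.
  refine (ENNReal.add_le_add_iff_right ENNReal.one_ne_top).1 ?_
  calc ∑ x ∈ A, siteMean hg hφ p t Λ x + μ C + 1
      = (∑ x ∈ A, siteMean hg hφ p t Λ x + evolved hg hφ p Λ t {ξ | (ξ : Config d) ∈ Cᶜ})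
          + μ C + evolved hg hφ p Λ t {ξ | (ξ : Config d) ∈ C} := by
        rw [← h3]
        ring
    _ ≤ (A.card * density g φ + μ Cᶜ) + μ C
          + evolved hg hφ p Λ t {ξ | (ξ : Config d) ∈ C} := by
        exact add_le_add_left (add_le_add_left h1 _) _
    _ = A.card * density g φ + evolved hg hφ p Λ t {ξ | (ξ : Config d) ∈ C} + 1 := by
        rw [← h4]
        ring

theorem isProbabilityMeasure_approxLaw (hg : IsRate g) {φ : ℝ} (hφ : 0 < φ) (hp : IsJumpLaw p)
    {t : ℝ} (ht : 0 ≤ t) (n : ℕ) :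
    IsProbabilityMeasure
      (approxLaw g p t n (fugacityMeasure d hg hφ : Measure (Config d))) :=
  have : IsProbabilityMeasure (evolveFin g p t
      (truncMeasure n (fugacityMeasure d hg hφ : Measure (Config d)))) :=
    isProbabilityMeasure_evolved hg hφ hp (box d n) ht
  Measure.isProbabilityMeasure_map Measurable.of_discrete.aemeasurable

theorem evolved_le_approxLaw (hg : IsRate g) {φ : ℝ} (hφ : 0 < φ) (p : Site d → ℝ) (t : ℝ)
    (n : ℕ) (G : Set (Config d)) :
    evolved hg hφ p (box d n) t {ξ | (ξ : Config d) ∈ G}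
      ≤ approxLaw g p t n (fugacityMeasure d hg hφ : Measure (Config d)) G :=
  Measure.le_map_apply Measurable.of_discrete.aemeasurable G

/-- The portmanteau condition on open sets, obtained by exhausting `G` by cylinder events. -/
theorem eventually_lt_approxLaw (hg : IsRate g) {φ : ℝ} (hφ : 0 < φ) (hp : IsJumpLaw p) {t : ℝ}
    (ht : 0 ≤ t) {G : Set (Config d)} (hG : IsOpen G) {c : ENNReal}
    (hc : c < (fugacityMeasure d hg hφ : Measure (Config d)) G) :
    ∀ᶠ n in atTop, c < approxLaw g p t n (fugacityMeasure d hg hφ : Measure (Config d)) G := by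
  set μ := (fugacityMeasure d hg hφ : Measure (Config d))
  rw [← iUnion_innerCylinder_box hG, (monotone_innerCylinder_box G).measure_iUnion,
    lt_iSup_iff] at hc
  obtain ⟨k, hk⟩ := hc
  have hR : (box d k).card * density g φ ≠ ⊤ :=
    ENNReal.mul_ne_top (ENNReal.natCast_ne_top _) (density_ne_top hg hφ)
  have h1 : Tendsto (fun n => ∑ x ∈ box d k, siteMean hg hφ p t (box d n) x
      + μ (innerCylinder (box d k) G)) atTop
      (𝓝 ((box d k).card * density g φ + μ (innerCylinder (box d k) G))) := by
    refine Tendsto.add_const _ ?_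
    have := tendsto_finsetSum (box d k) fun x _ => tendsto_siteMean_box hg hφ hp ht x
    rwa [Finset.sum_const, nsmul_eq_mul] at this
  have h2 : (box d k).card * density g φ + c
      < (box d k).card * density g φ + μ (innerCylinder (box d k) G) :=
    ENNReal.add_lt_add_left hR hk
  filter_upwards [h1.eventually_const_lt h2] with n hn
  have h3 := hn.trans_le (sum_siteMean_add_measure_le hg hφ hp ht (box d n) (box d k) G)
  have h4 : c < _ := lt_of_add_lt_add_left h3
  refine h4.trans_le (le_trans (measure_mono ?_) (evolved_le_approxLaw hg hφ p t n G))
  exact fun ξ hξ => innerCylinder_subset _ _ hξ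

end ZeroRange

end

theorem theorem2p2 (d : ℕ) (g : ℕ → ℝ) (hg : ZeroRange.IsRate g)
    (p : ZeroRange.Site d → ℝ) (hp : ZeroRange.IsJumpLaw p)
    (φ : ℝ) (hφ : 0 < φ) (t : ℝ) (ht : 0 ≤ t) :
    ZeroRange.EvolvesTo g p t
      (ZeroRange.fugacityMeasure d hg hφ) (ZeroRange.fugacityMeasure d hg hφ) := by
  refine ⟨ZeroRange.isProbabilityMeasure_approxLaw hg hφ hp ht,
    tendsto_of_forall_isOpen_le_liminf fun G hG => le_of_forall_lt_imp_le_of_dense fun c hc => ?_⟩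
  refine le_liminf_of_le (isCoboundedUnder_ge_of_le atTop (x := 1) fun n =>
    ProbabilityMeasure.apply_le_one _ G) ?_
  have hc' : (c : ENNReal)
      < (ZeroRange.fugacityMeasure d hg hφ : Measure (ZeroRange.Config d)) G := by
    rw [← ProbabilityMeasure.ennreal_coeFn_eq_coeFn_toMeasure]
    exact ENNReal.coe_lt_coe.2 hc
  filter_upwards [ZeroRange.eventually_lt_approxLaw hg hφ hp ht hG hc'] with n hn
  exact ENNReal.coe_le_coe.1 (hn.le.trans_eq
    (ProbabilityMeasure.ennreal_coeFn_eq_coeFn_toMeasure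
      (⟨_, _⟩ : ProbabilityMeasure (ZeroRange.Config d)) G).symm)
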